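/- Conventions. Let $D\subset\mathbb{R}^2$ be the closed unit disk and $B\subset\partial D$ a finite set. A \emph{smoothing with boundary $B$} is a compact one-dimensional submanifold of $D$ (a finite disjoint union of simple arcs and simple closed curves) that meets $\partial D$ exactly in its set of endpoints $B$. The category $\mathrm{Cob}(B)$ has these smoothings as objects; a morphism $O\to O'$ is a compact surface (necessarily orientable) properly and locally flatly embedded in $D\times[0,1]$ with boundary $(O\times\{0\})\cup(B\times[0,1])\cup(O'\times\{1\})$, which is a product near the bottom and the top, taken up to boundary-preserving ambient isotopy; composition is stacking followed by vertical renormalization. We regard $\mathrm{Cob}(B)$ as a preadditive category by replacing its Hom-sets by the free abelian groups on them. For a preadditive category $\mathcal{C}$, $\mathrm{Mat}(\mathcal{C})$ is the category of finite formal direct sums of objects of $\mathcal{C}$ and matrices of morphisms, and $\mathrm{Kom}(\mathcal{C})$ is the category of cochain complexes $\cdots\to C_i\xrightarrow{\partial_i}C_{i+1}\to\cdots$ over $\mathcal{C}$, with $\partial_{i+1}\circ\partial_i=0$ for all $i\in\mathbb{Z}$ and only finitely many nonzero terms, and chain maps. Let $T$ be an oriented tangle diagram in $D$ with endpoints $\partial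 T\subset\partial D$ and with crossings numbered $1,\dots,n$, of which $n_-$ are negative. For a word $w\in\{0,1\}^n$ let $T_w\in\mathrm{Cob}(\partial T)$ be the smoothing obtained by replacing, inside a small disk around it, the $k$-th crossing by its $w_k$-smoothing for each $k$; here the $0$-smoothing of a crossing joins the two regions swept out when the upper strand is rotated counterclockwise towards the lower strand, and the $1$-smoothing joins the other two regions. If $w_j=0$ and $w'$ is obtained from $w$ by changing the $j$-th letter to $1$, let $M_{w,j}\colon T_w\to T_{w'}$ be the cobordism that is a saddle over the small disk around the $j$-th crossing and a product with $[0,1]$ elsewhere. Define, for $i\in\mathbb{Z}$, $$\llbracket T\rrbracket^i=\bigoplus_{w\in\{0,1\}^n,\ \sum_k w_k=i+n_-}T_w\ \in\ \mathrm{Mat}(\mathrm{Cob}(\partial T)),$$ and let $\partial_i\colon\llbracket T\rrbracket^i\to\llbracket T\rrbracket^{i+1}$ be the matrix whose entry from $T_w$ to $T_{w'}$ is $(-1)^{\sum_{k<j}w_k}M_{w,j}$ if $w'$ is obtained from $w$ by changing the $j$-th letter from $0$ to $1$, and $0$ if there is no such $j$. Proposition. For every oriented tangle diagram $T$, the Khovanov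 bracket $\llbracket T\rrbracket=(\llbracket T\rrbracket^i,\partial_i)_{i\in\mathbb{Z}}$ is an object of $\mathrm{Kom}(\mathrm{Mat}(\mathrm{Cob}(\partial T)))$: one has $\partial_{i+1}\circ\partial_i=0$ for all $i\in\mathbb{Z}$, and only finitely many of the $\llbracket T\rrbracket^i$ are nonzero. -/

import Mathlib

open CategoryTheory Set

noncomputable section

namespace Khovanov

/-! ### Locally flat subsets of the disk and of the cylinder -/

/-- The closed unit disk. -/
abbrev Disk : Type := Metric.closedBall (0 : ℂ) 1

/-- The cylinder over the disk; the second coordinate is the height. -/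
abbrev Cylinder : Type := Disk × unitInterval

instance : CompactSpace Disk := isCompact_iff_compactSpace.mp (isCompact_closedBall 0 1)

/-- A point of the boundary circle, as a point of the disk. -/
def toDisk (z : Circle) : Disk := ⟨z, by simp [Circle.norm_coe]⟩

/-- The horizontal diameter of the disk. -/
def diameter : Set Disk := {z | (z : ℂ).im = 0}

/-- Near `p` the pair `(X, S)` is homeomorphic to the pair `(X, F)` near some point. -/
def LocallyModelledAt {X : Type} [TopologicalSpace X] (F S : Set X) (p : X) : Prop :=
  ∃ e : OpenPartialHomeomorph X X, p ∈ e.source ∧ ∀ x ∈ e.source, x ∈ S ↔ e x ∈ F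

/-- Every point of `S` has a neighbourhood in which the pair `(X, S)` looks like `(X, F)`. -/
def LocallyModelled {X : Type} [TopologicalSpace X] (F S : Set X) : Prop :=
  ∀ p ∈ S, LocallyModelledAt F S p

lemma LocallyModelledAt.pullback {X : Type} [TopologicalSpace X] {F S S' : Set X} {p : X}
    (g : OpenPartialHomeomorph X X) (hp : p ∈ g.source)
    (hg : ∀ x ∈ g.source, x ∈ S ↔ g x ∈ S') (h : LocallyModelledAt F S' (g p)) :
    LocallyModelledAt F S p := by
  obtain ⟨e, he, hs⟩ := h
  refine ⟨g.trans e, by simp [hp, he], fun x hx => ?_⟩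
  simp only [OpenPartialHomeomorph.trans_source, mem_inter_iff, mem_preimage] at hx
  rw [hg x hx.1, hs _ hx.2]; rfl

lemma LocallyModelledAt.congr {X : Type} [TopologicalSpace X] {F S S' : Set X} {p : X}
    (U : Set X) (hU : IsOpen U) (hp : p ∈ U) (h : ∀ x ∈ U, x ∈ S ↔ x ∈ S')
    (hS : LocallyModelledAt F S' p) : LocallyModelledAt F S p :=
  LocallyModelledAt.pullback (OpenPartialHomeomorph.ofSet U hU) hp h hS

lemma LocallyModelledAt.prod_univ {F S : Set Disk} {p : Cylinder}
    (h : LocallyModelledAt F S p.1) :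
    LocallyModelledAt (F ×ˢ (univ : Set unitInterval)) (S ×ˢ univ) p := by
  obtain ⟨e, he, hs⟩ := h
  refine ⟨e.prod (OpenPartialHomeomorph.refl _), by simp [he], fun x hx => ?_⟩
  have : x.1 ∈ e.source := by simpa using hx
  simpa using hs _ this

/-! ### Smoothings and cobordisms -/

/-- A smoothing with boundary `B`: a compact one-dimensional submanifold of the disk (a finite
disjoint union of simple arcs and simple closed curves), meeting the boundary circle exactly in
its endpoints, which are the points of `B`. -/
structure Smoothing (B : Finset Circle) where
  carrier : Set Disk
  isClosed : IsClosed carrier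
  flat : LocallyModelled diameter carrier
  boundary : ∀ z : Circle, toDisk z ∈ carrier ↔ z ∈ B

/-- A cobordism from `O` to `O'`: a compact surface embedded (properly, and locally flatly) in the
cylinder, whose boundary is `O × {0} ∪ B × [0, 1] ∪ O' × {1}`. As usual it is taken to be a product
near the bottom and near the top, so that cobordisms can be stacked. Every such surface is
orientable; since smoothings carry no orientation, none is chosen. -/
structure Cobordism {B : Finset Circle} (O O' : Smoothing B) where
  carrier : Set Cylinder
  isClosed : IsClosed carrier
  flat : LocallyModelled (diameter ×ˢ (univ : Set unitInterval)) carrier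
  side : ∀ (z : Circle) (t : unitInterval), (toDisk z, t) ∈ carrier ↔ z ∈ B
  collar : ∃ ε : ℝ, 0 < ε ∧
    (∀ (z : Disk) (t : unitInterval), (t : ℝ) ≤ ε → ((z, t) ∈ carrier ↔ z ∈ O.carrier)) ∧
    (∀ (z : Disk) (t : unitInterval), 1 - ε ≤ (t : ℝ) → ((z, t) ∈ carrier ↔ z ∈ O'.carrier))

/-- `S` and `S'` are related by a boundary preserving isotopy: a continuous family `H s` of
self-homeomorphisms of the cylinder, starting at the identity and carrying `S` to `S'`, which fixes
the bottom and the top disk pointwise and preserves each vertical line on the side. -/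
def Isotopic (S S' : Set Cylinder) : Prop :=
  ∃ H : unitInterval → Cylinder → Cylinder,
    Continuous (fun q : unitInterval × Cylinder => H q.1 q.2) ∧
    (∀ s, IsHomeomorph (H s)) ∧
    H 0 = id ∧
    H 1 '' S = S' ∧
    (∀ s z, H s (z, 0) = (z, 0)) ∧
    (∀ s z, H s (z, 1) = (z, 1)) ∧
    (∀ s (z : Circle) p, (H s p).1 = toDisk z ↔ p.1 = toDisk z)

lemma image_eq_iff {X : Type} {f : X → X} (hf : Function.Bijective f) {S S' : Set X} :
    f '' S = S' ↔ ∀ x, f x ∈ S' ↔ x ∈ S := by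
  constructor
  · rintro rfl x
    exact hf.1.mem_set_image
  · intro h
    ext y
    obtain ⟨x, rfl⟩ := hf.2 y
    rw [hf.1.mem_set_image, h]

lemma Isotopic.refl (S : Set Cylinder) : Isotopic S S :=
  ⟨fun _ => id, continuous_snd, fun _ => IsHomeomorph.id, rfl, by simp, by simp, by simp, by simp⟩

lemma Isotopic.symm {S S' : Set Cylinder} (h : Isotopic S S') : Isotopic S' S := by
  obtain ⟨H, hc, hh, h0, h1, hb, ht, hs⟩ := h
  obtain ⟨e, he⟩ : ∃ e : Cylinder ≃ₜ Cylinder, ∀ x, e x = H 1 x :=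
    ⟨(hh 1).homeomorph, fun _ => rfl⟩
  refine ⟨fun s p => H (unitInterval.symm s) (e.symm p), ?_, ?_, ?_, ?_, ?_, ?_, ?_⟩
  · exact hc.comp ((unitInterval.continuous_symm.comp continuous_fst).prodMk
      (e.symm.continuous.comp continuous_snd))
  · exact fun s => (hh _).comp e.symm.isHomeomorph
  · funext p
    simp [← he]
  · refine (image_eq_iff ((hh _).comp e.symm.isHomeomorph).bijective).2 fun x => ?_
    simp only [Function.comp_apply, unitInterval.symm_one, h0, id]
    rw [← (image_eq_iff (hh 1).bijective).1 h1 (e.symm x), ← he, e.apply_symm_apply]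
  · intro s z
    have : e.symm (z, 0) = (z, 0) := by rw [Homeomorph.symm_apply_eq, he, hb]
    simp [this, hb]
  · intro s z
    have : e.symm (z, 1) = (z, 1) := by rw [Homeomorph.symm_apply_eq, he, ht]
    simp [this, ht]
  · intro s z p
    rw [hs, ← hs 1, ← he, e.apply_symm_apply]

lemma Isotopic.trans {S S' S'' : Set Cylinder} (h : Isotopic S S') (h' : Isotopic S' S'') :
    Isotopic S S'' := by
  obtain ⟨H, hc, hh, h0, h1, hb, ht, hs⟩ := h
  obtain ⟨K, kc, kh, k0, k1, kb, kt, ks⟩ := h'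
  refine ⟨fun s p => K s (H s p), ?_, ?_, ?_, ?_, ?_, ?_, ?_⟩
  · exact kc.comp (continuous_fst.prodMk hc)
  · exact fun s => (kh s).comp (hh s)
  · simp [h0, k0]; rfl
  · rw [← k1, ← h1, image_image]
  · simp [hb, kb]
  · simp [ht, kt]
  · simp [hs, ks]

/-- Two sets that differ by an increasing reparametrization of the height are isotopic. -/
lemma Isotopic.of_reparam {S S' : Set Cylinder} (f : unitInterval → unitInterval)
    (hf : Continuous f) (hm : StrictMono f) (h0 : f 0 = 0) (h1 : f 1 = 1)
    (h : ∀ z t, (z, f t) ∈ S' ↔ (z, t) ∈ S) : Isotopic S S' := by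
  have mem : ∀ s t : unitInterval, (1 - (s : ℝ)) * t + s * f t ∈ Icc (0 : ℝ) 1 := by
    intro s t
    have hs := s.2; have ht := t.2; have hft := (f t).2
    simp only [mem_Icc] at hs ht hft ⊢
    constructor
    · have := mul_nonneg (sub_nonneg.2 hs.2) ht.1
      have := mul_nonneg hs.1 hft.1
      linarith
    · have := mul_le_mul_of_nonneg_left ht.2 (sub_nonneg.2 hs.2)
      have := mul_le_mul_of_nonneg_left hft.2 hs.1
      linarith
  let g : unitInterval → unitInterval → unitInterval := fun s t => ⟨_, mem s t⟩
  have gc : Continuous (fun q : unitInterval × unitInterval => g q.1 q.2) := by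
    apply Continuous.subtype_mk
    fun_prop
  have gm : ∀ s, StrictMono (g s) := by
    intro s a b hab
    have hs := s.2
    have h1 : (a : ℝ) < b := hab
    have h2 : (f a : ℝ) < f b := hm hab
    change (1 - (s : ℝ)) * a + s * f a < (1 - (s : ℝ)) * b + s * f b
    rcases eq_or_lt_of_le hs.1 with h | h
    · rw [← h]; linarith
    · have := mul_lt_mul_of_pos_left h2 h
      have := mul_le_mul_of_nonneg_left h1.le (sub_nonneg.2 hs.2)
      linarith
  have g0 : ∀ s, g s 0 = 0 := fun s => by ext; simp [g, h0]
  have g1 : ∀ s, g s 1 = 1 := fun s => by ext; simp [g, h1]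
  have gs : ∀ s, Function.Surjective (g s) := by
    intro s y
    have hcs : Continuous (g s) := gc.comp (continuous_const.prodMk continuous_id)
    have := intermediate_value_univ (0 : unitInterval) 1 hcs
    rw [g0, g1] at this
    exact this ⟨unitInterval.nonneg', unitInterval.le_one'⟩
  have bij : ∀ s, Function.Bijective (fun p : Cylinder => ((p.1, g s p.2) : Cylinder)) := fun s =>
    Function.Bijective.prodMap Function.bijective_id ⟨(gm s).injective, gs s⟩
  refine ⟨fun s p => (p.1, g s p.2), ?_, ?_, ?_, ?_, ?_, ?_, ?_⟩
  · exact (continuous_fst.comp continuous_snd).prodMk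
      (gc.comp (continuous_fst.prodMk (continuous_snd.comp continuous_snd)))
  · intro s
    rw [isHomeomorph_iff_continuous_bijective]
    exact ⟨continuous_fst.prodMk (gc.comp (continuous_const.prodMk continuous_snd)), bij s⟩
  · funext p
    refine Prod.ext rfl (Subtype.ext ?_)
    simp [g]
  · rw [image_eq_iff (bij 1)]
    rintro ⟨z, t⟩
    have : g 1 t = f t := by ext; simp [g]
    simp [this, h]
  · simp [g0]
  · simp [g1]
  · simp

/-! ### Stacking -/

/-- The height in the lower half of a stack, rescaled to the unit interval. -/
def lower (t : unitInterval) : unitInterval := projIcc 0 1 zero_le_one (2 * (t : ℝ))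

/-- The height in the upper half of a stack, rescaled to the unit interval. -/
def upper (t : unitInterval) : unitInterval := projIcc 0 1 zero_le_one (2 * (t : ℝ) - 1)

/-- `S₁` in the lower half of the cylinder and `S₂` in the upper half, vertically rescaled. -/
def stack (S₁ S₂ : Set Cylinder) : Set Cylinder :=
  {p | ((p.2 : ℝ) ≤ 1 / 2 ∧ (p.1, lower p.2) ∈ S₁) ∨ (1 / 2 ≤ (p.2 : ℝ) ∧ (p.1, upper p.2) ∈ S₂)}

lemma continuous_lower : Continuous lower := by unfold lower; fun_prop

lemma continuous_upper : Continuous upper := by unfold upper; fun_prop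

lemma coe_lower {t : unitInterval} (h : (t : ℝ) ≤ 1 / 2) : (lower t : ℝ) = 2 * t := by
  have := t.2.1
  rw [lower, projIcc_of_mem _ (by constructor <;> linarith)]

lemma coe_upper {t : unitInterval} (h : 1 / 2 ≤ (t : ℝ)) : (upper t : ℝ) = 2 * t - 1 := by
  have := t.2.2
  rw [upper, projIcc_of_mem _ (by constructor <;> linarith)]

/-- The inclusion of the lower half. -/
def half (t : unitInterval) : unitInterval :=
  ⟨t / 2, by have := t.2.1; have := t.2.2; constructor <;> linarith⟩

/-- The inclusion of the upper half. -/
def halfUp (t : unitInterval) : unitInterval :=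
  ⟨t / 2 + 1 / 2, by have := t.2.1; have := t.2.2; constructor <;> linarith⟩

lemma continuous_half : Continuous half := by unfold half; fun_prop

lemma continuous_halfUp : Continuous halfUp := by unfold halfUp; fun_prop

@[simp] lemma coe_half (t : unitInterval) : (half t : ℝ) = t / 2 := rfl

@[simp] lemma coe_halfUp (t : unitInterval) : (halfUp t : ℝ) = t / 2 + 1 / 2 := rfl

@[simp] lemma lower_half (t : unitInterval) : lower (half t) = t := by
  have := t.2.2
  ext; rw [coe_lower (by simp; linarith)]; simp; ring

@[simp] lemma upper_halfUp (t : unitInterval) : upper (halfUp t) = t := by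
  have := t.2.1
  ext; rw [coe_upper (by simp; linarith)]; simp; ring

lemma half_lower {t : unitInterval} (h : (t : ℝ) ≤ 1 / 2) : half (lower t) = t := by
  ext; simp [coe_lower h]

lemma halfUp_upper {t : unitInterval} (h : 1 / 2 ≤ (t : ℝ)) : halfUp (upper t) = t := by
  ext; rw [coe_halfUp, coe_upper h]; ring

lemma lower_eq_one {t : unitInterval} (h : (t : ℝ) = 1 / 2) : lower t = 1 := by
  ext; simp [coe_lower h.le, h]

lemma upper_eq_zero {t : unitInterval} (h : (t : ℝ) = 1 / 2) : upper t = 0 := by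
  ext; simp [coe_upper h.ge, h]

/-- Stacking of self-maps of the cylinder. -/
def stackMap (f g : Cylinder → Cylinder) (p : Cylinder) : Cylinder :=
  if (p.2 : ℝ) ≤ 1 / 2 then ((f (p.1, lower p.2)).1, half (f (p.1, lower p.2)).2)
  else ((g (p.1, upper p.2)).1, halfUp (g (p.1, upper p.2)).2)

lemma stackMap_lower {f g : Cylinder → Cylinder} {p : Cylinder} (h : (p.2 : ℝ) ≤ 1 / 2) :
    stackMap f g p = ((f (p.1, lower p.2)).1, half (f (p.1, lower p.2)).2) := by
  rw [stackMap, if_pos h]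

lemma stackMap_upper {f g : Cylinder → Cylinder} {p : Cylinder}
    (hf : ∀ z, f (z, 1) = (z, 1)) (hg : ∀ z, g (z, 0) = (z, 0)) (h : 1 / 2 ≤ (p.2 : ℝ)) :
    stackMap f g p = ((g (p.1, upper p.2)).1, halfUp (g (p.1, upper p.2)).2) := by
  rcases h.eq_or_lt with h | h
  · rw [stackMap, if_pos h.ge, lower_eq_one h.symm, upper_eq_zero h.symm, hf, hg]
    refine Prod.ext rfl (Subtype.ext ?_)
    simp
  · rw [stackMap, if_neg (not_le.2 h)]

lemma stackMap_comp {f g f' g' : Cylinder → Cylinder}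
    (hf : ∀ z, f (z, 1) = (z, 1)) (hg : ∀ z, g (z, 0) = (z, 0))
    (hf' : ∀ z, f' (z, 1) = (z, 1)) (hg' : ∀ z, g' (z, 0) = (z, 0)) (p : Cylinder) :
    stackMap f g (stackMap f' g' p) = stackMap (f ∘ f') (g ∘ g') p := by
  rcases le_total (p.2 : ℝ) (1 / 2) with h | h
  · rw [stackMap_lower h, stackMap_lower h, stackMap_lower]
    · simp
    · have := (f' (p.1, lower p.2)).2.2.2
      simp; linarith
  · rw [stackMap_upper hf' hg' h, stackMap_upper (by simp [hf, hf']) (by simp [hg, hg']) h,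
      stackMap_upper hf hg]
    · simp
    · have := (g' (p.1, upper p.2)).2.2.1
      simp; linarith

lemma stackMap_id (p : Cylinder) : stackMap id id p = p := by
  rcases le_total (p.2 : ℝ) (1 / 2) with h | h
  · rw [stackMap_lower h]; simp [half_lower h]
  · rw [stackMap_upper (by simp) (by simp) h]; simp [halfUp_upper h]

lemma stackMap_bijective {f g : Cylinder → Cylinder} (bf : Function.Bijective f)
    (bg : Function.Bijective g)
    (hf : ∀ z, f (z, 1) = (z, 1)) (hg : ∀ z, g (z, 0) = (z, 0)) :
    Function.Bijective (stackMap f g) := by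
  obtain ⟨f', hl, hr⟩ := Function.bijective_iff_has_inverse.1 bf
  obtain ⟨g', kl, kr⟩ := Function.bijective_iff_has_inverse.1 bg
  have hf' : ∀ z, f' (z, 1) = (z, 1) := fun z => by simpa [hf] using hl (z, 1)
  have hg' : ∀ z, g' (z, 0) = (z, 0) := fun z => by simpa [hg] using kl (z, 0)
  refine Function.bijective_iff_has_inverse.2 ⟨stackMap f' g', fun p => ?_, fun p => ?_⟩
  · rw [stackMap_comp hf' hg' hf hg, hl.comp_eq_id, kl.comp_eq_id, stackMap_id]
  · rw [stackMap_comp hf hg hf' hg', hr.comp_eq_id, kr.comp_eq_id, stackMap_id]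

/-- The two halves of a stack match along the middle disk. -/
def Match (S₁ S₂ : Set Cylinder) : Prop := ∀ z, (z, 1) ∈ S₁ ↔ (z, 0) ∈ S₂

lemma mem_stack_lower {S₁ S₂ : Set Cylinder} (hS : Match S₁ S₂) {p : Cylinder}
    (h : (p.2 : ℝ) ≤ 1 / 2) : p ∈ stack S₁ S₂ ↔ (p.1, lower p.2) ∈ S₁ := by
  simp only [stack, mem_ofPred_eq]
  constructor
  · rintro (h' | h')
    · exact h'.2
    · have e := le_antisymm h h'.1
      rw [lower_eq_one e, hS, ← upper_eq_zero e]
      exact h'.2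
  · exact fun h' => Or.inl ⟨h, h'⟩

lemma mem_stack_upper {S₁ S₂ : Set Cylinder} (hS : Match S₁ S₂) {p : Cylinder}
    (h : 1 / 2 ≤ (p.2 : ℝ)) : p ∈ stack S₁ S₂ ↔ (p.1, upper p.2) ∈ S₂ := by
  simp only [stack, mem_ofPred_eq]
  constructor
  · rintro (h' | h')
    · have e := le_antisymm h'.1 h
      rw [upper_eq_zero e, ← hS, ← lower_eq_one e]
      exact h'.2
    · exact h'.2
  · exact fun h' => Or.inr ⟨h, h'⟩

lemma Isotopic.stack {S₁ S₂ S₁' S₂' : Set Cylinder} (hS : Match S₁ S₂) (hS' : Match S₁' S₂')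
    (h₁ : Isotopic S₁ S₁') (h₂ : Isotopic S₂ S₂') :
    Isotopic (stack S₁ S₂) (stack S₁' S₂') := by
  obtain ⟨H, hc, hh, h0, h1, hb, ht, hs⟩ := h₁
  obtain ⟨K, kc, kh, k0, k1, kb, kt, ks⟩ := h₂
  have bij : ∀ s, Function.Bijective (stackMap (H s) (K s)) := fun s =>
    stackMap_bijective (hh s).bijective (kh s).bijective (ht s) (kb s)
  have cont : Continuous (fun q : unitInterval × Cylinder => stackMap (H q.1) (K q.1) q.2) := by
    have c1 : Continuous (fun q : unitInterval × Cylinder => H q.1 (q.2.1, lower q.2.2)) :=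
      hc.comp (continuous_fst.prodMk ((continuous_fst.comp continuous_snd).prodMk
        (continuous_lower.comp (continuous_snd.comp continuous_snd))))
    have c2 : Continuous (fun q : unitInterval × Cylinder => K q.1 (q.2.1, upper q.2.2)) :=
      kc.comp (continuous_fst.prodMk ((continuous_fst.comp continuous_snd).prodMk
        (continuous_upper.comp (continuous_snd.comp continuous_snd))))
    unfold stackMap
    refine Continuous.if_le ?_ ?_ (by fun_prop) continuous_const ?_
    · exact (continuous_fst.comp c1).prodMk (continuous_half.comp (continuous_snd.comp c1))
    · exact (continuous_fst.comp c2).prodMk (continuous_halfUp.comp (continuous_snd.comp c2))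
    · intro q hq
      rw [lower_eq_one hq, upper_eq_zero hq, ht, kb]
      refine Prod.ext rfl (Subtype.ext ?_)
      simp
  refine ⟨fun s => stackMap (H s) (K s), cont, ?_, ?_, ?_, ?_, ?_, ?_⟩
  · intro s
    rw [isHomeomorph_iff_continuous_bijective]
    exact ⟨cont.comp (continuous_const.prodMk continuous_id), bij s⟩
  · funext p
    simp only [h0, k0, stackMap_id, id]
  · rw [image_eq_iff (bij 1)]
    intro p
    rw [image_eq_iff (hh 1).bijective] at h1
    rw [image_eq_iff (kh 1).bijective] at k1
    rcases le_total (p.2 : ℝ) (1 / 2) with h | h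
    · rw [stackMap_lower h, mem_stack_lower hS h, mem_stack_lower hS']
      · simp [h1]
      · have := (H 1 (p.1, lower p.2)).2.2.2
        simp; linarith
    · rw [stackMap_upper (ht 1) (kb 1) h, mem_stack_upper hS h, mem_stack_upper hS']
      · simp [k1]
      · have := (K 1 (p.1, upper p.2)).2.2.1
        simp; linarith
  · intro s z
    show stackMap (H s) (K s) (z, 0) = (z, 0)
    rw [stackMap_lower (by simp)]
    have : lower 0 = 0 := by ext; rw [coe_lower] <;> simp
    simp only [this, hb]
    refine Prod.ext rfl (Subtype.ext ?_)
    simp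
  · intro s z
    show stackMap (H s) (K s) (z, 1) = (z, 1)
    rw [stackMap_upper (ht s) (kb s) (by norm_num)]
    have : upper 1 = 1 := by ext; rw [coe_upper] <;> norm_num
    simp only [this, kt]
    refine Prod.ext rfl (Subtype.ext ?_)
    simp; norm_num
  · intro s z p
    show (stackMap (H s) (K s) p).1 = toDisk z ↔ p.1 = toDisk z
    rcases le_total (p.2 : ℝ) (1 / 2) with h | h
    · rw [stackMap_lower h]; simp [hs]
    · rw [stackMap_upper (ht s) (kb s) h]; simp [ks]

lemma LocallyModelledAt.reparam {F : Set Disk} {S S' : Set Cylinder}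
    (f : unitInterval → unitInterval) (hf : Continuous f)
    (g : unitInterval → unitInterval) (hg : Continuous g)
    (U V : Set unitInterval) (hU : IsOpen U) (hV : IsOpen V)
    (hUV : ∀ t ∈ U, f t ∈ V) (hVU : ∀ t ∈ V, g t ∈ U)
    (hfg : ∀ t ∈ U, g (f t) = t) (hgf : ∀ t ∈ V, f (g t) = t)
    (hS : ∀ z, ∀ t ∈ U, (z, t) ∈ S ↔ (z, f t) ∈ S') {p : Cylinder} (hp : p.2 ∈ U)
    (h : LocallyModelledAt (F ×ˢ (univ : Set unitInterval)) S' (p.1, f p.2)) :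
    LocallyModelledAt (F ×ˢ (univ : Set unitInterval)) S p := by
  let e : OpenPartialHomeomorph unitInterval unitInterval :=
    { toFun := f, invFun := g, source := U, target := V, map_source' := hUV, map_target' := hVU
      left_inv' := hfg, right_inv' := hgf, open_source := hU, open_target := hV
      continuousOn_toFun := hf.continuousOn, continuousOn_invFun := hg.continuousOn }
  refine LocallyModelledAt.pullback ((OpenPartialHomeomorph.refl Disk).prod e) (S' := S') ?_ ?_ ?_
  · simpa [e] using hp
  · intro x hx
    have : x.2 ∈ U := by simpa [e] using hx
    exact hS x.1 x.2 this
  · exact h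

namespace Cobordism

variable {B : Finset Circle} {O O' O'' Q : Smoothing B}

lemma mem_zero (S : Cobordism O O') (z : Disk) : (z, 0) ∈ S.carrier ↔ z ∈ O.carrier := by
  obtain ⟨ε, h, h0, -⟩ := S.collar
  exact h0 z 0 (by simpa using h.le)

lemma mem_one (S : Cobordism O O') (z : Disk) : (z, 1) ∈ S.carrier ↔ z ∈ O'.carrier := by
  obtain ⟨ε, h, -, h1⟩ := S.collar
  exact h1 z 1 (by simpa using h.le)

lemma fits (S : Cobordism O O') (S' : Cobordism O' O'') : Match S.carrier S'.carrier :=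
  fun z => by rw [mem_one, mem_zero]

/-- The identity cobordism `O × [0, 1]`. -/
def refl (O : Smoothing B) : Cobordism O O where
  carrier := O.carrier ×ˢ univ
  isClosed := O.isClosed.prod isClosed_univ
  flat p hp := (O.flat p.1 hp.1).prod_univ
  side z t := by simpa using O.boundary z
  collar := ⟨1, one_pos, by simp, by simp⟩

/-- Composition of cobordisms: the second on top of the first, vertically renormalized. -/
def comp (S : Cobordism O O') (S' : Cobordism O' O'') : Cobordism O O'' where
  carrier := stack S.carrier S'.carrier
  isClosed := by
    have c : Continuous fun p : Cylinder => (p.2 : ℝ) := by fun_prop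
    have c1 : Continuous fun p : Cylinder => ((p.1, lower p.2) : Cylinder) :=
      continuous_fst.prodMk (continuous_lower.comp continuous_snd)
    have c2 : Continuous fun p : Cylinder => ((p.1, upper p.2) : Cylinder) :=
      continuous_fst.prodMk (continuous_upper.comp continuous_snd)
    exact ((isClosed_le c continuous_const).inter (S.isClosed.preimage c1)).union
      ((isClosed_le continuous_const c).inter (S'.isClosed.preimage c2))
  flat := by
    intro p hp
    have hm := S.fits S'
    rcases lt_trichotomy (p.2 : ℝ) (1 / 2) with h | h | h
    · rw [mem_stack_lower hm h.le] at hp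
      refine LocallyModelledAt.reparam lower continuous_lower half continuous_half
        {t | (t : ℝ) < 1 / 2} {t | (t : ℝ) < 1}
        (isOpen_lt continuous_subtype_val continuous_const)
        (isOpen_lt continuous_subtype_val continuous_const) ?_ ?_ ?_ ?_ ?_ h (S.flat _ hp)
      · intro t (ht : (t : ℝ) < 1 / 2)
        show (lower t : ℝ) < 1
        rw [coe_lower ht.le]; linarith
      · intro t (ht : (t : ℝ) < 1)
        show (half t : ℝ) < 1 / 2
        rw [coe_half]; linarith
      · intro t (ht : (t : ℝ) < 1 / 2)
        exact half_lower ht.le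
      · intro t _
        exact lower_half t
      · intro z t (ht : (t : ℝ) < 1 / 2)
        exact mem_stack_lower hm ht.le
    · obtain ⟨ε, hε, -, h1⟩ := S.collar
      obtain ⟨δ, hδ, h0, -⟩ := S'.collar
      have key : ∀ x : Cylinder, 1 / 2 - ε / 2 < (x.2 : ℝ) → (x.2 : ℝ) < 1 / 2 + δ / 2 →
          (x ∈ stack S.carrier S'.carrier ↔ x ∈ O'.carrier ×ˢ (univ : Set unitInterval)) := by
        intro x hx hx'
        rcases le_total (x.2 : ℝ) (1 / 2) with hh | hh
        · rw [mem_stack_lower hm hh, h1 _ _ (by rw [coe_lower hh]; linarith)]; simp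
        · rw [mem_stack_upper hm hh, h0 _ _ (by rw [coe_upper hh]; linarith)]; simp
      have c : Continuous fun p : Cylinder => (p.2 : ℝ) := by fun_prop
      refine LocallyModelledAt.congr
        {x | 1 / 2 - ε / 2 < (x.2 : ℝ) ∧ (x.2 : ℝ) < 1 / 2 + δ / 2}
        ((isOpen_lt continuous_const c).inter (isOpen_lt c continuous_const))
        ⟨by linarith, by linarith⟩ (fun x hx => key x hx.1 hx.2)
        (LocallyModelledAt.prod_univ (O'.flat _ ?_))
      exact ((key p (by linarith) (by linarith)).1 hp).1
    · rw [mem_stack_upper hm h.le] at hp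
      refine LocallyModelledAt.reparam upper continuous_upper halfUp continuous_halfUp
        {t | 1 / 2 < (t : ℝ)} {t | 0 < (t : ℝ)}
        (isOpen_lt continuous_const continuous_subtype_val)
        (isOpen_lt continuous_const continuous_subtype_val) ?_ ?_ ?_ ?_ ?_ h (S'.flat _ hp)
      · intro t (ht : 1 / 2 < (t : ℝ))
        show 0 < (upper t : ℝ)
        rw [coe_upper ht.le]; linarith
      · intro t (ht : 0 < (t : ℝ))
        show 1 / 2 < (halfUp t : ℝ)
        rw [coe_halfUp]; linarith
      · intro t (ht : 1 / 2 < (t : ℝ))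
        exact halfUp_upper ht.le
      · intro t _
        exact upper_halfUp t
      · intro z t (ht : 1 / 2 < (t : ℝ))
        exact mem_stack_upper hm ht.le
  side z t := by
    have hm := S.fits S'
    rcases le_total (t : ℝ) (1 / 2) with h | h
    · rw [mem_stack_lower hm h, S.side]
    · rw [mem_stack_upper hm h, S'.side]
  collar := by
    have hm := S.fits S'
    obtain ⟨ε, hε, h0, -⟩ := S.collar
    obtain ⟨δ, hδ, -, h1⟩ := S'.collar
    refine ⟨min (1 / 2) (min (ε / 2) (δ / 2)), by positivity, fun z t ht => ?_, fun z t ht => ?_⟩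
    · have hl : (t : ℝ) ≤ 1 / 2 := ht.trans (min_le_left _ _)
      have hl' : (t : ℝ) ≤ ε / 2 := ht.trans ((min_le_right _ _).trans (min_le_left _ _))
      rw [mem_stack_lower hm hl, h0 _ _ (by rw [coe_lower hl]; linarith)]
    · have a1 := min_le_left (1 / 2) (min (ε / 2) (δ / 2))
      have a2 := (min_le_right (1 / 2) (min (ε / 2) (δ / 2))).trans (min_le_right _ _)
      have hl : 1 / 2 ≤ (t : ℝ) := by linarith
      rw [mem_stack_upper hm hl, h1 _ _ (by rw [coe_upper hl]; linarith)]

/-- Cobordisms up to boundary preserving isotopy. -/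
instance setoid (O O' : Smoothing B) : Setoid (Cobordism O O') where
  r S S' := Isotopic S.carrier S'.carrier
  iseqv := ⟨fun _ => Isotopic.refl _, Isotopic.symm, Isotopic.trans⟩

lemma comp_congr {S₁ S₂ : Cobordism O O'} {S₁' S₂' : Cobordism O' O''} (h : S₁ ≈ S₂)
    (h' : S₁' ≈ S₂') : S₁.comp S₁' ≈ S₂.comp S₂' :=
  Isotopic.stack (S₁.fits S₁') (S₂.fits S₂') h h'

lemma refl_comp (S : Cobordism O O') : (refl O).comp S ≈ S := by
  refine Isotopic.symm ?_
  obtain ⟨ε', hε', hc, -⟩ := S.collar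
  obtain ⟨ε, hε, h1, hle⟩ : ∃ ε : ℝ, 0 < ε ∧ ε ≤ 1 ∧ ε ≤ ε' :=
    ⟨min ε' 1, by positivity, min_le_right _ _, min_le_left _ _⟩
  have hk : (1 + ε) / (2 * ε) * ε = (1 + ε) / 2 := by field_simp
  have hk1 : 1 ≤ (1 + ε) / (2 * ε) := by rw [le_div_iff₀ (by positivity)]; linarith
  set k := (1 + ε) / (2 * ε) with hkdef
  let f : unitInterval → unitInterval := fun t => ⟨min (k * t) ((1 + t) / 2), by
    have h0 := t.2.1; have h1 := t.2.2
    exact ⟨le_min (by positivity) (by linarith), (min_le_right _ _).trans (by linarith)⟩⟩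
  have fc : ∀ t, (f t : ℝ) = min (k * t) ((1 + t) / 2) := fun _ => rfl
  refine Isotopic.of_reparam f (by fun_prop) ?_ ?_ ?_ ?_
  · intro a b hab
    have hab : (a : ℝ) < b := hab
    show min (k * a) ((1 + (a : ℝ)) / 2) < min (k * b) ((1 + (b : ℝ)) / 2)
    exact min_lt_min (by nlinarith) (by linarith)
  · ext; simp [f]
  · ext; simp only [fc]; norm_num; exact hk1
  · intro z t
    have hm := (refl O).fits S
    show (z, f t) ∈ stack (refl O).carrier S.carrier ↔ _
    have hr : (f t : ℝ) ≤ (1 + t) / 2 := min_le_right _ _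
    rcases le_total (t : ℝ) ε with h | h
    · rw [hc z t (h.trans hle)]
      rcases le_total (f t : ℝ) (1 / 2) with h' | h'
      · rw [mem_stack_lower hm h']; simp [refl]
      · rw [mem_stack_upper hm h', hc]
        rw [coe_upper h']; linarith
    · have e : (f t : ℝ) = (1 + t) / 2 := by
        rw [fc, min_eq_right]; nlinarith
      have h' : 1 / 2 ≤ (f t : ℝ) := by rw [e]; linarith
      rw [mem_stack_upper hm h']
      have : upper (f t) = t := by ext; rw [coe_upper h', e]; ring
      simp only [this]

lemma comp_refl (S : Cobordism O O') : S.comp (refl O') ≈ S := by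
  refine Isotopic.symm ?_
  obtain ⟨ε', hε', -, hc⟩ := S.collar
  obtain ⟨ε, hε, h1, hle⟩ : ∃ ε : ℝ, 0 < ε ∧ ε ≤ 1 ∧ ε ≤ ε' :=
    ⟨min ε' 1, by positivity, min_le_right _ _, min_le_left _ _⟩
  have hk : (1 + ε) / (2 * ε) * ε = (1 + ε) / 2 := by field_simp
  have hk1 : 1 ≤ (1 + ε) / (2 * ε) := by rw [le_div_iff₀ (by positivity)]; linarith
  set k := (1 + ε) / (2 * ε) with hkdef
  let f : unitInterval → unitInterval := fun t => ⟨max (1 - k * (1 - t)) (t / 2), by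
    have h0 := t.2.1; have h1 := t.2.2
    have : 0 ≤ k * (1 - t) := mul_nonneg (by linarith) (by linarith)
    exact ⟨le_max_of_le_right (by positivity), max_le (by linarith) (by linarith)⟩⟩
  have fc : ∀ t, (f t : ℝ) = max (1 - k * (1 - t)) (t / 2) := fun _ => rfl
  refine Isotopic.of_reparam f (by fun_prop) ?_ ?_ ?_ ?_
  · intro a b hab
    have hab : (a : ℝ) < b := hab
    show max (1 - k * (1 - (a : ℝ))) (a / 2) < max (1 - k * (1 - (b : ℝ))) (b / 2)
    exact max_lt_max (by nlinarith) (by linarith)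
  · ext; simp only [fc]; norm_num; exact hk1
  · ext; simp only [fc]; norm_num
  · intro z t
    have hm := S.fits (refl O')
    show (z, f t) ∈ stack S.carrier (refl O').carrier ↔ _
    have hr : (t : ℝ) / 2 ≤ (f t : ℝ) := le_max_right _ _
    rcases le_total (1 - ε) (t : ℝ) with h | h
    · rw [hc z t (by linarith)]
      rcases le_total (f t : ℝ) (1 / 2) with h' | h'
      · rw [mem_stack_lower hm h', hc]
        rw [coe_lower h']; linarith
      · rw [mem_stack_upper hm h']; simp [refl]
    · have e : (f t : ℝ) = t / 2 := by
        rw [fc, max_eq_right]; nlinarith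
      have h' : (f t : ℝ) ≤ 1 / 2 := by rw [e]; linarith [t.2.2]
      rw [mem_stack_lower hm h']
      have : lower (f t) = t := by ext; rw [coe_lower h', e]; ring
      simp only [this]

lemma comp_assoc (S₁ : Cobordism O O') (S₂ : Cobordism O' O'') (S₃ : Cobordism O'' Q) :
    (S₁.comp S₂).comp S₃ ≈ S₁.comp (S₂.comp S₃) := by
  refine Isotopic.symm ?_
  let f : unitInterval → unitInterval := fun t => ⟨max (t / 2) (max (t - 1 / 4) (2 * t - 1)), by
    have h0 := t.2.1; have h1 := t.2.2
    exact ⟨le_max_of_le_left (by positivity),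
      max_le (by linarith) (max_le (by linarith) (by linarith))⟩⟩
  have fc : ∀ t, (f t : ℝ) = max ((t : ℝ) / 2) (max ((t : ℝ) - 1 / 4) (2 * t - 1)) := fun _ => rfl
  refine Isotopic.of_reparam f (by fun_prop) ?_ ?_ ?_ ?_
  · intro a b hab
    have hab : (a : ℝ) < b := hab
    show (f a : ℝ) < f b
    rw [fc, fc]
    exact max_lt_max (by linarith) (max_lt_max (by linarith) (by linarith))
  · ext; simp only [fc]; norm_num
  · ext; simp only [fc]; norm_num
  · intro z t
    have hm := (S₁.comp S₂).fits S₃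
    have hm' := S₁.fits (S₂.comp S₃)
    show (z, f t) ∈ stack (S₁.comp S₂).carrier S₃.carrier ↔
      (z, t) ∈ stack S₁.carrier (S₂.comp S₃).carrier
    rcases le_total (t : ℝ) (1 / 2) with h | h
    · have e : (f t : ℝ) = t / 2 := by
        rw [fc, max_eq_left]; exact max_le (by linarith) (by linarith)
      have h' : (f t : ℝ) ≤ 1 / 2 := by rw [e]; linarith
      have h'' : lower (f t) = t := by ext; rw [coe_lower h', e]; ring
      rw [mem_stack_lower hm h', mem_stack_lower hm' h]
      simp only [h'']
      exact mem_stack_lower (S₁.fits S₂) h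
    · rw [mem_stack_upper hm' h]
      rcases le_total (t : ℝ) (3 / 4) with k | k
      · have e : (f t : ℝ) = t - 1 / 4 := by
          rw [fc, max_eq_right, max_eq_left]
          · linarith
          · exact le_max_of_le_left (by linarith)
        have h' : (f t : ℝ) ≤ 1 / 2 := by rw [e]; linarith
        have u' : 1 / 2 ≤ (lower (f t) : ℝ) := by rw [coe_lower h', e]; linarith
        have u'' : (upper t : ℝ) ≤ 1 / 2 := by rw [coe_upper h]; linarith
        rw [mem_stack_lower hm h']
        refine (mem_stack_upper (S₁.fits S₂) u').trans
          (Iff.trans ?_ (mem_stack_lower (S₂.fits S₃) u'').symm)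
        have : upper (lower (f t)) = lower (upper t) := by
          ext; rw [coe_upper u', coe_lower u'', coe_lower h', coe_upper h, e]; ring
        simp only [this]
      · have e : (f t : ℝ) = 2 * t - 1 := by
          rw [fc, max_eq_right, max_eq_right]
          · linarith
          · exact le_max_of_le_right (by linarith)
        have h' : 1 / 2 ≤ (f t : ℝ) := by rw [e]; linarith
        have u'' : 1 / 2 ≤ (upper t : ℝ) := by rw [coe_upper h]; linarith
        rw [mem_stack_upper hm h']
        refine Iff.trans ?_ (mem_stack_upper (S₂.fits S₃) u'').symm
        have : f t = upper t := by ext; rw [coe_upper h, e]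
        simp only [this]

end Cobordism

/-- The category `Cob(B)`: its objects are the smoothings with boundary `B`. -/
abbrev Cob (B : Finset Circle) : Type := Smoothing B

/-- Morphisms of `Cob(B)` are cobordisms up to boundary preserving isotopy; `f ≫ g` is `g` placed
on top of `f`. -/
instance (B : Finset Circle) : Category (Cob B) where
  Hom O O' := Quotient (Cobordism.setoid O O')
  id O := Quotient.mk _ (Cobordism.refl O)
  comp f g := Quotient.map₂ Cobordism.comp
    (fun _ _ h _ _ h' => Cobordism.comp_congr h h') f g
  id_comp f := Quotient.inductionOn f fun S => Quotient.sound S.refl_comp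
  comp_id f := Quotient.inductionOn f fun S => Quotient.sound S.comp_refl
  assoc f g h := Quotient.inductionOn₃ f g h fun S₁ S₂ S₃ => Quotient.sound (S₁.comp_assoc S₂ S₃)

/-! ### Charts -/

lemma exists_chart {E : Type} [NormedAddCommGroup E] [NormedSpace ℝ E] [FiniteDimensional ℝ E]
    (f : E → ℝ) (f' l : E →L[ℝ] ℝ) (a b : E) (hf : HasStrictFDerivAt f f' a) (hf' : f' ≠ 0)
    (hl : l ≠ 0) (ha : f a = 0) (hb : l b = 0) :
    ∃ e : OpenPartialHomeomorph E E, a ∈ e.source ∧ e a = b ∧ ∀ x ∈ e.source, f x = l (e x) := by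
  have : CompleteSpace E := FiniteDimensional.complete ℝ E
  obtain ⟨u, hu⟩ : ∃ u, l u = 1 := by
    obtain ⟨v, hv⟩ := DFunLike.ne_iff.1 hl
    have hv : l v ≠ 0 := hv
    exact ⟨(l v)⁻¹ • v, by simp [hv]⟩
  obtain ⟨v, hv⟩ : ∃ v, f' v = 1 := by
    obtain ⟨v, hv⟩ := DFunLike.ne_iff.1 hf'
    have hv : f' v ≠ 0 := hv
    exact ⟨(f' v)⁻¹ • v, by simp [hv]⟩
  have hl0 : (l : E →ₗ[ℝ] ℝ) ≠ 0 := fun h => hl (by ext x; simpa using LinearMap.congr_fun h x)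
  have hf0 : (f' : E →ₗ[ℝ] ℝ) ≠ 0 := fun h => hf' (by ext x; simpa using LinearMap.congr_fun h x)
  have hrank : Module.finrank ℝ (LinearMap.ker (f' : E →ₗ[ℝ] ℝ)) =
      Module.finrank ℝ (LinearMap.ker (l : E →ₗ[ℝ] ℝ)) := by
    have h1 := Module.Dual.finrank_ker_add_one_of_ne_zero hl0
    have h2 := Module.Dual.finrank_ker_add_one_of_ne_zero hf0
    omega
  let K := LinearEquiv.ofFinrankEq _ _ hrank
  let P : E →ₗ[ℝ] LinearMap.ker (f' : E →ₗ[ℝ] ℝ) :=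
    LinearMap.codRestrict _ (LinearMap.id - (f' : E →ₗ[ℝ] ℝ).smulRight v) (by simp [hv])
  let A₀ : E →ₗ[ℝ] E :=
    (Submodule.subtype _) ∘ₗ K.toLinearMap ∘ₗ P + (f' : E →ₗ[ℝ] ℝ).smulRight u
  have hA₀ : ∀ x, l (A₀ x) = f' x := by
    intro x
    have : l (K (P x)) = 0 := (K (P x)).2
    simp [A₀, this, hu]
  have hinj : Function.Injective A₀ := by
    rw [← LinearMap.ker_eq_bot, LinearMap.ker_eq_bot']
    intro x hx
    have h1 : f' x = 0 := by rw [← hA₀, hx, map_zero]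
    have h2 : K (P x) = 0 := by
      ext
      simpa [A₀, h1] using hx
    have h3 : P x = 0 := by simpa using h2
    have h4 : x - f' x • v = 0 := congrArg Subtype.val h3
    simpa [h1] using h4
  let A : E ≃L[ℝ] E := (LinearEquiv.ofInjectiveEndo A₀ hinj).toContinuousLinearEquiv
  have hA : ∀ x, l (A x) = f' x := hA₀
  let φ : E → E := fun x => A (x - a) + (f x - f' (x - a)) • u + b
  have hφ : HasStrictFDerivAt φ (A : E →L[ℝ] E) a := by
    have h1 : HasStrictFDerivAt (fun x => x - a) (ContinuousLinearMap.id ℝ E) a :=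
      (hasStrictFDerivAt_id a).sub_const a
    have h2 := (A : E →L[ℝ] E).hasStrictFDerivAt.comp a h1
    have h3 := f'.hasStrictFDerivAt.comp a h1
    have h4 := (h2.add ((hf.sub h3).smul_const u)).add_const b
    refine h4.congr_fderiv ?_
    ext x; simp
  refine ⟨hφ.toOpenPartialHomeomorph φ, hφ.mem_toOpenPartialHomeomorph_source, ?_, fun x _ => ?_⟩
  · rw [hφ.toOpenPartialHomeomorph_coe]; simp [φ, ha]
  · rw [hφ.toOpenPartialHomeomorph_coe]; simp [φ, hA, hu, hb]

/-- The inclusion of the open disk in the plane. -/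
def diskChart : OpenPartialHomeomorph Disk ℂ where
  toFun := (↑)
  invFun z := if h : ‖z‖ ≤ 1 then ⟨z, by simpa using h⟩ else ⟨0, by simp⟩
  source := {z | ‖(z : ℂ)‖ < 1}
  target := {z | ‖z‖ < 1}
  map_source' _ h := h
  map_target' z h := by
    have h : ‖z‖ < 1 := h
    simpa [h.le] using h
  left_inv' z h := by
    have h : ‖(z : ℂ)‖ < 1 := h
    simp [h.le]
  right_inv' z h := by
    have h : ‖z‖ < 1 := h
    simp [h.le]
  open_source := isOpen_lt (by fun_prop) continuous_const
  open_target := isOpen_lt (by fun_prop) continuous_const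
  continuousOn_toFun := continuous_subtype_val.continuousOn
  continuousOn_invFun := by
    rw [Topology.IsInducing.subtypeVal.continuousOn_iff]
    refine continuousOn_id.congr fun z h => ?_
    have h : ‖z‖ < 1 := h
    simp [h.le]

/-- The inclusion of the open unit interval in the line. -/
def intervalChart : OpenPartialHomeomorph unitInterval ℝ where
  toFun := (↑)
  invFun := projIcc 0 1 zero_le_one
  source := {t | (t : ℝ) ∈ Ioo 0 1}
  target := Ioo 0 1
  map_source' _ h := h
  map_target' t h := by
    have : (projIcc (0 : ℝ) 1 zero_le_one t : ℝ) = t := by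
      rw [projIcc_of_mem _ (Ioo_subset_Icc_self h)]
    show (projIcc (0 : ℝ) 1 zero_le_one t : ℝ) ∈ Ioo (0 : ℝ) 1
    rwa [this]
  left_inv' t _ := by simp
  right_inv' t h := by rw [projIcc_of_mem _ (Ioo_subset_Icc_self h)]
  open_source := isOpen_Ioo.preimage continuous_subtype_val
  open_target := isOpen_Ioo
  continuousOn_toFun := continuous_subtype_val.continuousOn
  continuousOn_invFun := continuous_projIcc.continuousOn

/-! ### The local model of a crossing and of a saddle -/

/-- A continuously differentiable function vanishing on the negative half line. -/
def ramp (x : ℝ) : ℝ := max x 0 ^ 2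

lemma ramp_of_nonpos {x : ℝ} (h : x ≤ 0) : ramp x = 0 := by simp [ramp, h]

lemma ramp_of_nonneg {x : ℝ} (h : 0 ≤ x) : ramp x = x ^ 2 := by simp [ramp, h]

lemma hasDerivAt_ramp (x : ℝ) : HasDerivAt ramp (2 * max x 0) x := by
  rcases lt_trichotomy x 0 with h | h | h
  · rw [max_eq_right h.le, mul_zero]
    refine (hasDerivAt_const x (0 : ℝ)).congr_of_eventuallyEq ?_
    filter_upwards [Iio_mem_nhds h] with y hy using ramp_of_nonpos (le_of_lt hy)
  · subst h
    have : HasFDerivAt ramp (0 : ℝ →L[ℝ] ℝ) 0 := by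
      refine Asymptotics.IsBigO.hasFDerivAt (n := 2) ?_ (by norm_num)
      refine Asymptotics.IsBigO.of_bound 1 (Filter.Eventually.of_forall fun y => ?_)
      rcases le_total y 0 with hy | hy
      · rw [ramp_of_nonpos hy]; simp; positivity
      · rw [ramp_of_nonneg hy]; simp
    simpa using this.hasDerivAt
  · rw [max_eq_left h.le]
    have := (hasDerivAt_pow 2 x).congr_of_eventuallyEq (f₁ := ramp) (by
      filter_upwards [Ioi_mem_nhds h] with y hy using ramp_of_nonneg (le_of_lt hy))
    simpa using this

lemma hasStrictDerivAt_ramp (x : ℝ) : HasStrictDerivAt ramp (2 * max x 0) x :=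
  hasStrictDerivAt_of_hasDerivAt_of_continuousAt
    (Filter.Eventually.of_forall hasDerivAt_ramp) (by fun_prop)

/-- A radial function on the plane, positive on the open unit disk and zero outside it. -/
def bump (z : ℂ) : ℝ := ramp (1 - (z.re ^ 2 + z.im ^ 2))

lemma bump_of_one_le {z : ℂ} (h : 1 ≤ ‖z‖) : bump z = 0 := by
  refine ramp_of_nonpos ?_
  have := Complex.sq_norm z
  rw [Complex.normSq_apply] at this
  nlinarith

/-- The parameter of the two smoothings of a crossing. -/
def level (b : Bool) : ℝ := if b then 1 / 8 else -1 / 8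

/-- The parameter of the level sets of a saddle: it increases from the parameter of the
`0`-smoothing to that of the `1`-smoothing, being constant for `t ≤ 1/4` and for `t ≥ 3/4`, and it
vanishes, with non-zero derivative, at `t = 1/2` only. -/
def saddleLevel (t : ℝ) : ℝ :=
  (ramp (4 * t - 1) - 2 * ramp (4 * t - 2) + ramp (4 * t - 3) - 1) / 8

lemma saddleLevel_of_le {t : ℝ} (h : t ≤ 1 / 4) : saddleLevel t = level false := by
  rw [saddleLevel, ramp_of_nonpos, ramp_of_nonpos, ramp_of_nonpos] <;> try linarith
  norm_num [level]

lemma saddleLevel_of_ge {t : ℝ} (h : 3 / 4 ≤ t) : saddleLevel t = level true := by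
  rw [saddleLevel, ramp_of_nonneg, ramp_of_nonneg, ramp_of_nonneg] <;> try linarith
  simp only [level]; norm_num; ring

lemma abs_saddleLevel_le (t : ℝ) : |saddleLevel t| ≤ 1 / 8 := by
  rw [abs_le]
  rcases le_total t (1 / 4) with h | h
  · rw [saddleLevel_of_le h]; norm_num [level]
  rcases le_total (3 / 4) t with h' | h'
  · rw [saddleLevel_of_ge h']; norm_num [level]
  rcases le_total t (1 / 2) with k | k
  · rw [saddleLevel, ramp_of_nonneg, ramp_of_nonpos, ramp_of_nonpos] <;> try linarith
    constructor <;> nlinarith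
  · rw [saddleLevel, ramp_of_nonneg, ramp_of_nonneg, ramp_of_nonpos] <;> try linarith
    constructor <;> nlinarith

lemma eq_half_of_saddleLevel_eq_zero {t : ℝ} (h0 : saddleLevel t = 0) : t = 1 / 2 := by
  rcases le_total t (1 / 4) with h | h
  · rw [saddleLevel_of_le h] at h0; norm_num [level] at h0
  rcases le_total (3 / 4) t with h' | h'
  · rw [saddleLevel_of_ge h'] at h0; norm_num [level] at h0
  rcases le_total t (1 / 2) with k | k
  · rw [saddleLevel, ramp_of_nonneg, ramp_of_nonpos, ramp_of_nonpos] at h0 <;> try linarith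
    nlinarith
  · rw [saddleLevel, ramp_of_nonneg, ramp_of_nonneg, ramp_of_nonpos] at h0 <;> try linarith
    nlinarith

lemma hasStrictDerivAt_saddleLevel (t : ℝ) : HasStrictDerivAt saddleLevel
    ((2 * max (4 * t - 1) 0 * 4 - 2 * (2 * max (4 * t - 2) 0 * 4) + 2 * max (4 * t - 3) 0 * 4) / 8)
    t := by
  have h (c : ℝ) : HasStrictDerivAt (fun t : ℝ => ramp (4 * t - c)) (2 * max (4 * t - c) 0 * 4) t := by
    have h1 : HasStrictDerivAt (fun t : ℝ => 4 * t - c) 4 t := by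
      have := ((hasStrictDerivAt_id t).const_mul (4 : ℝ)).sub_const c
      rw [mul_one] at this
      exact this
    exact (hasStrictDerivAt_ramp _).comp t h1
  have := HasStrictDerivAt.div_const ((((h 1).sub ((h 2).const_mul 2)).add (h 3)).sub_const 1) 8
  exact this

/-- A height-dependent parameter whose level sets sweep out an embedded surface. -/
def Admissible (F : ℝ → ℝ) : Prop :=
  ∀ t, |F t| ≤ 1 / 8 ∧ ∃ F', HasStrictDerivAt F F' t ∧ (F t = 0 → F' ≠ 0)

lemma admissible_saddleLevel : Admissible saddleLevel := fun t =>
  ⟨abs_saddleLevel_le t, _, hasStrictDerivAt_saddleLevel t, fun h => by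
    rw [eq_half_of_saddleLevel_eq_zero h]; norm_num⟩

lemma admissible_level (b : Bool) : Admissible fun _ => level b := fun t =>
  ⟨by cases b <;> norm_num [level, abs_le], 0, hasStrictDerivAt_const t _, fun h => by
    cases b <;> norm_num [level] at h⟩

lemma hasStrictFDerivAt_crossing (F : ℝ → ℝ) (hF : Admissible F) (p : ℂ × ℝ)
    (hp : p.1.re * p.1.im = F p.2 * bump p.1) :
    ∃ G : ℂ × ℝ →L[ℝ] ℝ,
      HasStrictFDerivAt (fun q : ℂ × ℝ => q.1.re * q.1.im - F q.2 * bump q.1) G p ∧ G ≠ 0 ∧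
      (F p.2 ≠ 0 → G ∘L ContinuousLinearMap.inl ℝ ℂ ℝ ≠ 0) := by
  obtain ⟨z, t⟩ := p
  obtain ⟨habs, F', hF', hne⟩ := hF t
  have hx : HasStrictFDerivAt (fun q : ℂ × ℝ => q.1.re)
      (Complex.reCLM ∘L ContinuousLinearMap.fst ℝ ℂ ℝ) (z, t) :=
    (Complex.reCLM ∘L ContinuousLinearMap.fst ℝ ℂ ℝ).hasStrictFDerivAt
  have hy : HasStrictFDerivAt (fun q : ℂ × ℝ => q.1.im)
      (Complex.imCLM ∘L ContinuousLinearMap.fst ℝ ℂ ℝ) (z, t) :=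
    (Complex.imCLM ∘L ContinuousLinearMap.fst ℝ ℂ ℝ).hasStrictFDerivAt
  have ht : HasStrictFDerivAt (fun q : ℂ × ℝ => q.2)
      (ContinuousLinearMap.snd ℝ ℂ ℝ) (z, t) :=
    (ContinuousLinearMap.snd ℝ ℂ ℝ).hasStrictFDerivAt
  have hb := (hasStrictDerivAt_ramp (1 - (z.re ^ 2 + z.im ^ 2))).comp_hasStrictFDerivAt (z, t)
    (f := fun q : ℂ × ℝ => 1 - (q.1.re ^ 2 + q.1.im ^ 2)) (((hx.pow 2).add (hy.pow 2)).const_sub 1)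
  have hFt := hF'.comp_hasStrictFDerivAt (z, t) (f := fun q : ℂ × ℝ => q.2) ht
  have hG := (hx.mul hy).sub (hFt.mul hb)
  set g := 2 * max (1 - (z.re ^ 2 + z.im ^ 2)) 0 with hg
  have hg0 : 0 ≤ g := by positivity
  have hg2 : g ≤ 2 := by
    have : max (1 - (z.re ^ 2 + z.im ^ 2)) 0 ≤ 1 := max_le (by nlinarith [sq_nonneg z.re, sq_nonneg z.im]) (by norm_num)
    linarith
  have spatial : (∀ w : ℂ, z.re * w.im + z.im * w.re + F t * g * 2 * (z.re * w.re + z.im * w.im) = 0)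
      → F t = 0 ∧ bump z = 1 := by
    intro h
    have h1 := h 1
    have h2 := h Complex.I
    simp at h1 h2
    have hc : |F t * g * 2| ≤ 1 / 2 := by
      rw [abs_mul, abs_mul, abs_of_nonneg hg0, abs_two]
      nlinarith [abs_nonneg (F t)]
    set c := F t * g * 2 with hcdef
    have hc2 : c ^ 2 ≤ 1 / 4 := by
      rw [← sq_abs]; nlinarith [abs_nonneg c]
    have e1 : z.im = -(c * z.re) := by linarith
    have e2 : z.re * (1 - c ^ 2) = 0 := by rw [e1] at h2; linarith
    have e3 : z.re = 0 := by
      rcases mul_eq_zero.1 e2 with h | h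
      · exact h
      · nlinarith
    have e4 : z.im = 0 := by rw [e1, e3]; ring
    have e5 : bump z = 1 := by simp [bump, e3, e4, ramp]
    refine ⟨?_, e5⟩
    have : z.re * z.im = F t * bump z := hp
    rw [e3, e5] at this
    linarith
  refine ⟨_, hG, ?_, ?_⟩
  · intro h0
    have hval : ∀ w : ℂ × ℝ, z.re * w.1.im + z.im * w.1.re
        + F t * g * 2 * (z.re * w.1.re + z.im * w.1.im) - bump z * F' * w.2 = 0 := by
      intro w
      have := DFunLike.congr_fun h0 w
      simp at this
      rw [← this]
      simp only [bump]
      ring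
    obtain ⟨hF0, hb1⟩ := spatial fun w => by simpa using hval (w, 0)
    have := hval (0, 1)
    rw [hb1] at this
    simp at this
    exact hne hF0 this
  · intro hFne h0
    refine hFne (spatial fun w => ?_).1
    have := DFunLike.congr_fun h0 w
    simp at this
    rw [← this]
    ring

lemma flat_curve_chart (χ : ℂ → Disk) (hχ : Topology.IsOpenEmbedding χ) (S : Set Disk) (b : Bool)
    (hS : ∀ z, χ z ∈ S ↔ z.re * z.im = level b * bump z) (z : ℂ) (hz : χ z ∈ S) :
    LocallyModelledAt diameter S (χ z) := by
  have hz' := (hS z).1 hz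
  obtain ⟨G, hG, -, hne⟩ := hasStrictFDerivAt_crossing _ (admissible_level b) (z, 0) hz'
  have hG' := hG.comp z (f := fun w : ℂ => (w, (0 : ℝ))) (ContinuousLinearMap.inl ℝ ℂ ℝ).hasStrictFDerivAt
  have hne' := hne (by cases b <;> norm_num [level])
  obtain ⟨e, he, hea, hs⟩ := exists_chart _ _ Complex.imCLM z 0 hG' hne'
    (fun h => by simpa using DFunLike.congr_fun h Complex.I) (by simp [hz']) (by simp)
  refine ⟨((hχ.toOpenPartialHomeomorph χ).symm.trans e).trans diskChart.symm, ?_, ?_⟩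
  · have hw0 : (hχ.toOpenPartialHomeomorph χ).symm (χ z) = z :=
      (hχ.toOpenPartialHomeomorph χ).left_inv (by simp)
    simp [he, hea, hw0, diskChart]
  · intro x hx
    simp only [OpenPartialHomeomorph.trans_source, OpenPartialHomeomorph.symm_source, mem_inter_iff,
      mem_preimage] at hx
    obtain ⟨⟨hx1, hx2⟩, hx3⟩ := hx
    obtain ⟨w, rfl⟩ : x ∈ range χ := by simpa using hx1
    have hw : (hχ.toOpenPartialHomeomorph χ).symm (χ w) = w :=
      (hχ.toOpenPartialHomeomorph χ).left_inv (by simp)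
    rw [hw] at hx2
    simp only [OpenPartialHomeomorph.coe_trans, Function.comp_apply, hw] at hx3 ⊢
    have hd : ((diskChart.symm (e w) : Disk) : ℂ) = e w := diskChart.right_inv hx3
    rw [hS, diameter, mem_ofPred_eq, hd]
    have := hs w hx2
    simp at this
    rw [← this, sub_eq_zero]

lemma flat_surface_chart (χ : ℂ → Disk) (hχ : Topology.IsOpenEmbedding χ) (S : Set Cylinder)
    (F : ℝ → ℝ) (hF : Admissible F)
    (hS : ∀ z (t : unitInterval), (χ z, t) ∈ S ↔ z.re * z.im = F t * bump z)
    (z : ℂ) (t : unitInterval) (ht : (t : ℝ) ∈ Ioo 0 1) (hz : (χ z, t) ∈ S) :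
    LocallyModelledAt (diameter ×ˢ (univ : Set unitInterval)) S (χ z, t) := by
  have hz' := (hS z t).1 hz
  obtain ⟨G, hG, hne, -⟩ := hasStrictFDerivAt_crossing F hF (z, t) hz'
  obtain ⟨e, he, hea, hs⟩ := exists_chart _ _ (Complex.imCLM ∘L ContinuousLinearMap.fst ℝ ℂ ℝ)
    (z, (t : ℝ)) (0, 1 / 2) hG hne
    (fun h => by simpa using DFunLike.congr_fun h (Complex.I, 0)) (by simp [hz']) (by simp)
  refine ⟨(((hχ.toOpenPartialHomeomorph χ).symm.prod intervalChart).trans e).trans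
    (diskChart.prod intervalChart).symm, ?_, ?_⟩
  · have h1 : intervalChart t = (t : ℝ) := rfl
    have h2 : t ∈ intervalChart.source := ht
    have h3 : (0 : ℂ) ∈ diskChart.target := by simp [diskChart]
    have h4 : (1 / 2 : ℝ) ∈ intervalChart.target := by
      show (1 / 2 : ℝ) ∈ Ioo (0 : ℝ) 1
      norm_num
    have h4' : (2⁻¹ : ℝ) ∈ intervalChart.target := by simpa using h4
    have hw0 : (hχ.toOpenPartialHomeomorph χ).symm (χ z) = z :=
      (hχ.toOpenPartialHomeomorph χ).left_inv (by simp)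
    simp [he, hea, hw0, h1, h2, h3, h4']
  · rintro ⟨x, s⟩ hx
    simp only [OpenPartialHomeomorph.trans_source, OpenPartialHomeomorph.symm_source, mem_inter_iff,
      mem_preimage] at hx
    obtain ⟨⟨hx1, hx2⟩, hx3⟩ := hx
    obtain ⟨w, rfl⟩ : x ∈ range χ := by simpa using hx1.1
    have hw : (hχ.toOpenPartialHomeomorph χ).symm (χ w) = w :=
      (hχ.toOpenPartialHomeomorph χ).left_inv (by simp)
    have hw' : ((hχ.toOpenPartialHomeomorph χ).symm.prod intervalChart) (χ w, s) = (w, (s : ℝ)) :=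
      Prod.ext hw rfl
    rw [hw'] at hx2
    simp only [OpenPartialHomeomorph.coe_trans, Function.comp_apply, hw'] at hx3 ⊢
    have hd : (((diskChart.prod intervalChart).symm (e (w, (s : ℝ)))).1 : ℂ) = (e (w, (s : ℝ))).1 :=
      diskChart.right_inv hx3.1
    have := hs _ hx2
    simp at this
    rw [hS, mem_prod, diameter, mem_ofPred_eq, hd, ← this, sub_eq_zero]
    simp

/-! ### Oriented tangle diagrams -/

/-- The oriented compact one-manifold consisting of `a` intervals and `b` circles. -/
abbrev Strands (a b : ℕ) : Type := (Fin a × unitInterval) ⊕ (Fin b × Circle)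

/-- The boundary points of `Strands a b`: the endpoints of the intervals. -/
def IsEndpoint {a b : ℕ} : Strands a b → Prop
  | Sum.inl (_, t) => t = 0 ∨ t = 1
  | Sum.inr _ => False

/-- A path running along one of the strands in the direction of its orientation. -/
def IsForward {a b : ℕ} (α : ℝ → Strands a b) : Prop :=
  (∃ (j : Fin a) (c : ℝ → unitInterval), Continuous c ∧ StrictMono c ∧
    ∀ x, α x = Sum.inl (j, c x)) ∨
  (∃ (j : Fin b) (c : ℝ → ℝ), Continuous c ∧ StrictMono c ∧
    ∀ x, α x = Sum.inr (j, Circle.exp (c x)))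

/-- An embedding `χ` of the plane preserves orientation: the image of the counterclockwise unit
circle winds once counterclockwise around `χ 0`. -/
def PreservesOrientation (χ : ℂ → Disk) : Prop :=
  ∃ θ : ℝ → ℝ, Continuous θ ∧ (∀ x, θ (x + 2 * Real.pi) = θ x + 2 * Real.pi) ∧
    ∀ x, (χ (Circle.exp x) : ℂ) - χ 0 = ‖(χ (Circle.exp x) : ℂ) - χ 0‖ * Circle.exp (θ x)

/-- An oriented tangle diagram in the disk, with numbered crossings: an oriented compact
one-manifold, immersed in the disk with its endpoints on the boundary circle, whose only
singularities are finitely many transverse double points, at each of which one of the two strands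
is marked as the upper one. -/
structure OrientedTangleDiagram where
  /-- The number of open strands. -/
  arcs : ℕ
  /-- The number of closed strands. -/
  loops : ℕ
  /-- The number `n` of crossings. -/
  n : ℕ
  curve : Strands arcs loops → Disk
  continuous_curve : Continuous curve
  norm_curve : ∀ m, ‖(curve m : ℂ)‖ = 1 ↔ IsEndpoint m
  /-- An orientation preserving coordinate system of the plane around each crossing, centred at the
  crossing. The real axis is the upper strand, which is directed to the right; the imaginary axis
  is the lower strand. -/
  chart : Fin n → ℂ → Disk
  isOpenEmbedding_chart : ∀ k, Topology.IsOpenEmbedding (chart k)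
  norm_chart : ∀ k z, ‖(chart k z : ℂ)‖ < 1
  preservesOrientation_chart : ∀ k, PreservesOrientation (chart k)
  disjoint_chart : Pairwise fun k l => Disjoint (range (chart k)) (range (chart l))
  /-- The sign of a crossing: it is positive if the lower strand is directed upwards in the chart,
  and negative if it is directed downwards. -/
  sign : Fin n → ℤˣ
  crossing : ∀ k, ∃ upperStrand lowerStrand : ℝ → Strands arcs loops,
    IsForward upperStrand ∧ IsForward lowerStrand ∧
    (∀ x : ℝ, curve (upperStrand x) = chart k x) ∧
    (∀ x : ℝ, curve (lowerStrand x) = chart k (((sign k : ℤ) * x : ℝ) * Complex.I)) ∧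
    ∀ m, curve m ∈ range (chart k) → m ∈ range upperStrand ∪ range lowerStrand
  /-- There are no double points other than the crossings. -/
  injective : ∀ m m', curve m = curve m' → m = m' ∨ ∃ k, curve m = chart k 0
  /-- Away from the crossings the diagram is a one-dimensional submanifold of the disk. -/
  flat : ∀ p ∈ range curve, (∀ k, p ≠ chart k 0) → LocallyModelledAt diameter (range curve) p

namespace OrientedTangleDiagram

variable (T : OrientedTangleDiagram)

lemma finite_boundary : {z : Circle | toDisk z ∈ range T.curve}.Finite := by
  have h1 : {m : Strands T.arcs T.loops | IsEndpoint m}.Finite := by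
    refine Set.Finite.subset (((Set.finite_univ (α := Fin T.arcs)).prod
      (Set.toFinite ({0, 1} : Set unitInterval))).image Sum.inl) ?_
    rintro (⟨j, t⟩ | m) h
    · exact ⟨(j, t), ⟨mem_univ _, h⟩, rfl⟩
    · exact h.elim
  have h2 : Function.Injective toDisk := fun x y h => by
    ext; exact congrArg (fun p : Disk => (p : ℂ)) h
  refine ((h1.image T.curve).preimage h2.injOn).subset ?_
  rintro z ⟨m, hm⟩
  exact ⟨m, (T.norm_curve m).1 (by rw [hm]; exact Circle.norm_coe z), hm⟩

/-- The set `∂T` of endpoints of `T` on the boundary circle. -/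
def boundary : Finset Circle := T.finite_boundary.toFinset

lemma mem_boundary (z : Circle) : z ∈ T.boundary ↔ toDisk z ∈ range T.curve := by
  simp [boundary]

lemma isClosed_range : IsClosed (range T.curve) :=
  (isCompact_range T.continuous_curve).isClosed

lemma chart_mem_range (k : Fin T.n) (z : ℂ) : T.chart k z ∈ range T.curve ↔ z.re * z.im = 0 := by
  obtain ⟨u, l, -, -, hu, hl, h⟩ := T.crossing k
  have inj := (T.isOpenEmbedding_chart k).injective
  constructor
  · rintro ⟨m, hm⟩
    rcases h m ⟨z, hm.symm⟩ with ⟨x, rfl⟩ | ⟨x, rfl⟩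
    · rw [hu] at hm
      rw [← inj hm]; simp
    · rw [hl] at hm
      rw [← inj hm]; simp
  · intro h0
    rcases mul_eq_zero.1 h0 with h0 | h0
    · refine ⟨l ((T.sign k : ℤ) * z.im), ?_⟩
      rw [hl]
      congr 1
      rcases Int.units_eq_one_or (T.sign k) with h1 | h1 <;>
        apply Complex.ext <;> simp [h1, h0]
    · refine ⟨u z.re, ?_⟩
      rw [hu]
      congr 1
      apply Complex.ext <;> simp [h0]

/-- The diagram with its crossings resolved: in the small disk around the `k`-th crossing it is
replaced by the curve `x y = f k * bump (x + i y)`. For `-1/8 ≤ f k < 0` this curve consists of two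
arcs, in the second and in the fourth quadrant (the `0`-smoothing); for `0 < f k ≤ 1/8` it consists
of two arcs in the first and in the third quadrant (the `1`-smoothing). -/
def resolve (f : Fin T.n → ℝ) : Set Disk :=
  {p | p ∈ range T.curve ∧ ∀ k, p ∉ T.chart k '' Metric.ball 0 1} ∪
    ⋃ k, T.chart k '' {z | ‖z‖ ≤ 1 ∧ z.re * z.im = f k * bump z}

lemma chart_eq {k l : Fin T.n} {z w : ℂ} (h : T.chart k z = T.chart l w) : k = l ∧ z = w := by
  have hk : k = l := by
    by_contra hkl
    exact Set.disjoint_left.1 (T.disjoint_chart hkl) ⟨z, rfl⟩ (h ▸ ⟨w, rfl⟩)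
  subst hk
  exact ⟨rfl, (T.isOpenEmbedding_chart k).injective h⟩

lemma chart_mem_resolve (f : Fin T.n → ℝ) (k : Fin T.n) (z : ℂ) :
    T.chart k z ∈ T.resolve f ↔ z.re * z.im = f k * bump z := by
  constructor
  · rintro (⟨h1, h2⟩ | h)
    · have : 1 ≤ ‖z‖ := by
        by_contra hz
        exact h2 k ⟨z, by simpa using hz, rfl⟩
      rw [(T.chart_mem_range k z).1 h1, bump_of_one_le this, mul_zero]
    · obtain ⟨l, w, hw, e⟩ := mem_iUnion.1 h
      obtain ⟨rfl, rfl⟩ := T.chart_eq e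
      exact hw.2
  · intro h
    rcases le_total ‖z‖ 1 with hz | hz
    · exact Or.inr (mem_iUnion.2 ⟨k, z, ⟨hz, h⟩, rfl⟩)
    · refine Or.inl ⟨?_, ?_⟩
      · rw [chart_mem_range, h, bump_of_one_le hz, mul_zero]
      · rintro l ⟨w, hw, e⟩
        obtain ⟨rfl, rfl⟩ := T.chart_eq e
        have : ‖w‖ < 1 := by simpa using hw
        linarith

lemma mem_resolve_of_notMem (f : Fin T.n → ℝ) {p : Disk}
    (hp : ∀ k, p ∉ T.chart k '' Metric.closedBall 0 1) : p ∈ T.resolve f ↔ p ∈ range T.curve := by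
  constructor
  · rintro (h | h)
    · exact h.1
    · obtain ⟨l, w, hw, e⟩ := mem_iUnion.1 h
      exact (hp l ⟨w, by simpa using hw.1, e⟩).elim
  · exact fun h => Or.inl ⟨h, fun k hk => hp k (image_mono Metric.ball_subset_closedBall hk)⟩

/-- The complement of the small disks around the crossings. -/
def outside : Set Disk := {p | ∀ k, p ∉ T.chart k '' Metric.closedBall 0 1}

lemma isOpen_outside : IsOpen T.outside := by
  have : T.outside = ⋂ k, (T.chart k '' Metric.closedBall 0 1)ᶜ := by
    ext; simp [outside]
  rw [this]
  exact isOpen_iInter_of_finite fun k => (((isCompact_closedBall 0 1).image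
    (T.isOpenEmbedding_chart k).continuous).isClosed).isOpen_compl

lemma mem_outside_or (p : Disk) : p ∈ T.outside ∨ ∃ k z, p = T.chart k z := by
  by_cases h : p ∈ T.outside
  · exact Or.inl h
  · simp only [outside, mem_ofPred_eq, not_forall, not_not] at h
    obtain ⟨k, z, -, e⟩ := h
    exact Or.inr ⟨k, z, e.symm⟩

lemma flat_outside {p : Disk} (hp : p ∈ range T.curve) (h : p ∈ T.outside) :
    LocallyModelledAt diameter (range T.curve) p :=
  T.flat p hp fun k e => h k ⟨0, by simp, e.symm⟩

lemma continuous_bump : Continuous bump := by unfold bump ramp; fun_prop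

/-- The region swept out by a family of resolutions is closed. -/
lemma isClosed_movie (F : ℝ → Fin T.n → ℝ) (hF : ∀ k, Continuous fun t => F t k) :
    IsClosed {p : Cylinder | p.1 ∈ T.resolve (F p.2)} := by
  have h : {p : Cylinder | p.1 ∈ T.resolve (F p.2)} =
      (({p : Disk | p ∈ range T.curve} ∩ ⋂ k, (T.chart k '' Metric.ball 0 1)ᶜ) ×ˢ univ) ∪
      ⋃ k, (fun q : ℂ × unitInterval => (T.chart k q.1, q.2)) ''
        ((Metric.closedBall 0 1 ×ˢ univ) ∩ {q | q.1.re * q.1.im = F q.2 k * bump q.1}) := by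
    ext ⟨p, t⟩
    simp only [resolve, mem_ofPred_eq, mem_union, mem_iUnion, mem_image, mem_prod, mem_inter_iff,
      mem_iInter, mem_compl_iff, mem_univ, and_true, Prod.mk.injEq, Prod.exists,
      mem_closedBall_zero_iff]
    refine or_congr Iff.rfl (exists_congr fun k => ⟨?_, ?_⟩)
    · rintro ⟨z, hz, e⟩
      exact ⟨z, t, hz, e, rfl⟩
    · rintro ⟨z, s, hz, e, rfl⟩
      exact ⟨z, hz, e⟩
  rw [h]
  refine IsClosed.union (IsClosed.prod (T.isClosed_range.inter
    (isClosed_iInter fun k => ?_)) isClosed_univ) (isClosed_iUnion_of_finite fun k => ?_)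
  · exact ((T.isOpenEmbedding_chart k).isOpenMap _ Metric.isOpen_ball).isClosed_compl
  · refine IsCompact.isClosed (IsCompact.image ?_ ?_)
    · refine ((isCompact_closedBall 0 1).prod isCompact_univ).inter_right (isClosed_eq ?_ ?_)
      · fun_prop
      · exact ((hF k).comp (continuous_subtype_val.comp continuous_snd)).mul
          (continuous_bump.comp continuous_fst)
    · exact ((T.isOpenEmbedding_chart k).continuous.comp continuous_fst).prodMk continuous_snd

lemma mem_resolve_side (f : Fin T.n → ℝ) (z : Circle) :
    toDisk z ∈ T.resolve f ↔ z ∈ T.boundary := by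
  rw [mem_boundary, mem_resolve_of_notMem]
  rintro k ⟨w, -, e⟩
  have := T.norm_chart k w
  rw [e] at this
  exact absurd (Circle.norm_coe z) this.ne

/-- The smoothing of `T` associated to a state: the letter `false` stands for `0`, the letter
`true` for `1`. -/
def smoothing (w : Fin T.n → Bool) : Smoothing T.boundary where
  carrier := T.resolve fun k => level (w k)
  isClosed := by
    have h := T.isClosed_movie (fun _ k => level (w k)) (fun _ => continuous_const)
    exact h.preimage (continuous_id.prodMk (continuous_const (y := (0 : unitInterval))))
  flat := by
    intro p hp
    rcases T.mem_outside_or p with h | ⟨k, z, rfl⟩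
    · exact LocallyModelledAt.congr T.outside T.isOpen_outside h
        (fun x hx => T.mem_resolve_of_notMem _ hx)
        (T.flat_outside ((T.mem_resolve_of_notMem _ h).1 hp) h)
    · exact flat_curve_chart _ (T.isOpenEmbedding_chart k) _ (w k)
        (fun z => T.chart_mem_resolve _ k z) z hp
  boundary := T.mem_resolve_side _

/-- There is an arrow of the cube from `w` to `w'`, at the `j`-th letter: `w'` is obtained from `w`
by changing the `j`-th letter from `0` to `1`. -/
def IsArrow {n : ℕ} (j : Fin n) (w w' : Fin n → Bool) : Prop :=
  w j = false ∧ w' = Function.update w j true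

/-- The sign of the arrow out of `w` at the `j`-th letter. -/
def arrowSign {n : ℕ} (j : Fin n) (w : Fin n → Bool) : ℤ :=
  (-1) ^ (Finset.univ.filter fun i => i < j ∧ w i = true).card

/-- The parameters of the level sets of the saddle at the `j`-th crossing: constant at the other
crossings. -/
def saddleFamily (w : Fin T.n → Bool) (j : Fin T.n) (t : ℝ) (k : Fin T.n) : ℝ :=
  if k = j then saddleLevel t else level (w k)

lemma admissible_saddleFamily (w : Fin T.n → Bool) (j k : Fin T.n) :
    Admissible fun t => T.saddleFamily w j t k := by
  by_cases h : k = j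
  · simpa [saddleFamily, h] using admissible_saddleLevel
  · simpa [saddleFamily, h] using admissible_level (w k)

lemma saddleFamily_of_le {w w' : Fin T.n → Bool} {j : Fin T.n} (h : IsArrow j w w') {t : ℝ}
    (ht : t ≤ 1 / 4) : T.saddleFamily w j t = fun k => level (w k) := by
  funext k
  by_cases hk : k = j
  · subst hk; simp [saddleFamily, saddleLevel_of_le ht, h.1]
  · simp [saddleFamily, hk]

lemma saddleFamily_of_ge {w w' : Fin T.n → Bool} {j : Fin T.n} (h : IsArrow j w w') {t : ℝ}
    (ht : 3 / 4 ≤ t) : T.saddleFamily w j t = fun k => level (w' k) := by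
  funext k
  rw [h.2]
  by_cases hk : k = j
  · subst hk; simp [saddleFamily, saddleLevel_of_ge ht]
  · simp [saddleFamily, hk]

/-- The cobordism attached to an arrow of the cube: the product with the interval outside the small
disk around the `j`-th crossing, and a saddle inside; its level set at height `t` is the curve of
`resolve` with parameter `saddleLevel t` at the `j`-th crossing. -/
def saddle {w w' : Fin T.n → Bool} {j : Fin T.n} (h : IsArrow j w w') :
    Cobordism (T.smoothing w) (T.smoothing w') where
  carrier := {p | p.1 ∈ T.resolve (T.saddleFamily w j p.2)}
  isClosed := T.isClosed_movie _ fun k => continuous_iff_continuousAt.2 fun t => by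
    obtain ⟨-, F', hF', -⟩ := T.admissible_saddleFamily w j k t
    exact hF'.hasDerivAt.continuousAt
  flat := by
    rintro ⟨p, t⟩ hp
    have c : Continuous fun p : Cylinder => (p.2 : ℝ) := by fun_prop
    have hp : p ∈ T.resolve (T.saddleFamily w j t) := hp
    rcases lt_or_ge (t : ℝ) (1 / 4) with ht | ht
    · rw [T.saddleFamily_of_le h ht.le] at hp
      refine LocallyModelledAt.congr {q | (q.2 : ℝ) < 1 / 4} (isOpen_lt c continuous_const) ht
        (S' := (T.smoothing w).carrier ×ˢ univ) (fun q hq => ?_)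
        (LocallyModelledAt.prod_univ ((T.smoothing w).flat p hp))
      rw [mem_ofPred_eq, T.saddleFamily_of_le h (le_of_lt hq)]
      simp [smoothing]
    rcases lt_or_ge (3 / 4) (t : ℝ) with ht' | ht'
    · rw [T.saddleFamily_of_ge h ht'.le] at hp
      refine LocallyModelledAt.congr {q | 3 / 4 < (q.2 : ℝ)} (isOpen_lt continuous_const c) ht'
        (S' := (T.smoothing w').carrier ×ˢ univ) (fun q hq => ?_)
        (LocallyModelledAt.prod_univ ((T.smoothing w').flat p hp))
      rw [mem_ofPred_eq, T.saddleFamily_of_ge h (le_of_lt hq)]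
      simp [smoothing]
    rcases T.mem_outside_or p with ho | ⟨k, z, rfl⟩
    · refine LocallyModelledAt.congr (Prod.fst ⁻¹' T.outside)
        (T.isOpen_outside.preimage continuous_fst) ho
        (S' := range T.curve ×ˢ univ) (fun q hq => ?_)
        (LocallyModelledAt.prod_univ (T.flat_outside ((T.mem_resolve_of_notMem _ ho).1 hp) ho))
      rw [mem_ofPred_eq, T.mem_resolve_of_notMem _ hq]
      simp
    · exact flat_surface_chart _ (T.isOpenEmbedding_chart k) _ _
        (T.admissible_saddleFamily w j k) (fun z s => T.chart_mem_resolve _ k z) z t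
        ⟨by linarith, by linarith⟩ hp
  side z t := T.mem_resolve_side _ z
  collar := by
    refine ⟨1 / 4, by norm_num, fun z t ht => ?_, fun z t ht => ?_⟩
    · rw [mem_ofPred_eq, T.saddleFamily_of_le h ht]; rfl
    · rw [mem_ofPred_eq, T.saddleFamily_of_ge h (by linarith)]; rfl

end OrientedTangleDiagram

/-! ### Complexes and the Khovanov bracket -/

/-- The preadditive category generated by `Cob(B)`: the same objects, with the free abelian groups
on the sets of morphisms. -/
abbrev AddCob (B : Finset Circle) : Type := Free ℤ (Cob B)

/-- Cochain complexes of finite length: only finitely many terms are not the zero object. -/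
def finiteLength (C : Type*) [Category C] [Preadditive C] : ObjectProperty (CochainComplex C ℤ) :=
  fun K => {i : ℤ | ¬ Limits.IsZero (K.X i)}.Finite

/-- The category `Kom(C)` of complexes of finite length in `C` and chain maps. -/
abbrev Kom (C : Type*) [Category C] [Preadditive C] : Type _ := (finiteLength C).FullSubcategory

namespace OrientedTangleDiagram

variable (T : OrientedTangleDiagram)

/-- The number of negative crossings. -/
def nNeg : ℕ := (Finset.univ.filter fun k => T.sign k = -1).card

/-- The states placed in homological degree `i`: those with exactly `i + n₋` letters `1`. -/
abbrev State (i : ℤ) : Type :=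
  {w : Fin T.n → Bool // ((Finset.univ.filter fun k => w k = true).card : ℤ) = i + T.nNeg}

/-- The term of the Khovanov bracket in degree `i`: the formal direct sum of the smoothings
associated to the states of this degree. -/
def bracketX (i : ℤ) : Mat_ (AddCob T.boundary) where
  ι := T.State i
  X w := Free.of ℤ (T.smoothing w.1)

open Classical in
/-- The differential of the Khovanov bracket: the entry from `w` to `w'` is the signed saddle
cobordism if there is an arrow from `w` to `w'` (which is then at exactly one letter `j`), and zero
otherwise. -/
def bracketD (i : ℤ) : T.bracketX i ⟶ T.bracketX (i + 1) := fun w w' =>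
  ∑ j : Fin T.n, if h : IsArrow j w.1 w'.1 then
    arrowSign j w.1 • (Free.embedding ℤ (Cob T.boundary)).map (Quotient.mk _ (T.saddle h))
  else 0

end OrientedTangleDiagram

end Khovanov

end

noncomputable section
namespace Khovanov

/-! An entry of `∂ ∘ ∂` from a state `w` to a state `x` is a signed sum over the paths of length two
from `w` to `x` in the cube `{0,1}^n`. Such a path raises a letter `j` and then a different letter
`k`; it is matched with the path that raises `k` first and `j` second, the two being the sides of
one face of the cube. They cancel for two reasons: the sign products along the two sides are
opposite (`arrowSign_comm`), and the two composites of saddles are the same morphism of `Cob`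
(`saddle_comm`).

The second reason is geometric: saddles over disjoint disks can exchange their heights. All the
surfaces involved are movies, whose level set at height `t` is a resolution of the diagram with
parameters depending on `t`. A stack of two saddles is, as a set, such a movie, with one parameter
moving in the lower half and the other in the upper half (`saddle_comp_saddle`). The parameter of a
crossing is felt only inside its small disk (`mem_resolve_congr`); elsewhere in the chart the movie
is vertical. Heights may therefore be reparametrized by an amount that varies over the disk: fully
over the small disk of one crossing, not at all over the charts of the others, with a cutoff
function in between, where vertical motion leaves the surface unchanged. In this way
`isotopic_movie` delays the first saddle to the time of the second. Both orders of the saddles are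
thus isotopic to one movie with two simultaneous saddles.

Finiteness of the complex holds because a word of length `n` has between `0` and `n` letters `1`. -/

/-! ### Isotopies along the vertical lines of the cylinder -/

/-- The isotopy is the straight line from the identity to `f z` on each vertical line. It never
changes the point of the disk, so the condition on the side is automatic. In contrast to
`Isotopic.of_reparam`, the reparametrization may depend on `z`, which permits moving one saddle
while the others stay in place. -/
lemma Isotopic.of_fibrewise_reparam {S S' : Set Cylinder} (f : Disk → unitInterval → unitInterval)
    (hf : Continuous fun p : Cylinder => f p.1 p.2) (hm : ∀ z, StrictMono (f z))
    (h0 : ∀ z, f z 0 = 0) (h1 : ∀ z, f z 1 = 1)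
    (h : ∀ z t, (z, f z t) ∈ S' ↔ (z, t) ∈ S) : Isotopic S S' := by
  have mem : ∀ (s : unitInterval) z (t : unitInterval),
      (1 - (s : ℝ)) * t + s * f z t ∈ Icc (0 : ℝ) 1 := fun s z t =>
    convex_Icc (0 : ℝ) 1 t.2 (f z t).2 (sub_nonneg.2 s.2.2) s.2.1 (by ring)
  let g : unitInterval → Disk → unitInterval → unitInterval := fun s z t => ⟨_, mem s z t⟩
  have gc : Continuous fun q : unitInterval × Cylinder => g q.1 q.2.1 q.2.2 := by
    have : Continuous fun q : unitInterval × Cylinder => f q.2.1 q.2.2 := hf.comp continuous_snd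
    apply Continuous.subtype_mk
    fun_prop
  have gm : ∀ s z, StrictMono (g s z) := by
    intro s z a b hab
    have h1 : (a : ℝ) < b := hab
    have h2 : (f z a : ℝ) < f z b := hm z hab
    change (1 - (s : ℝ)) * a + s * f z a < (1 - (s : ℝ)) * b + s * f z b
    -- At `s = 0` strictness has to come from the identity part of the combination; for `s > 0` it
    -- comes from `f z`.
    rcases eq_or_lt_of_le s.2.1 with h | h
    · rw [← h]; linarith
    · have := mul_lt_mul_of_pos_left h2 h
      have := mul_le_mul_of_nonneg_left h1.le (sub_nonneg.2 s.2.2)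
      linarith
  have g0 : ∀ s z, g s z 0 = 0 := fun s z => by ext; simp [g, h0]
  have g1 : ∀ s z, g s z 1 = 1 := fun s z => by ext; simp [g, h1]
  have gs : ∀ s z, Function.Surjective (g s z) := by
    intro s z y
    have hcs : Continuous (g s z) :=
      gc.comp (continuous_const.prodMk (continuous_const.prodMk continuous_id))
    have := intermediate_value_univ (0 : unitInterval) 1 hcs
    rw [g0, g1] at this
    exact this ⟨unitInterval.nonneg', unitInterval.le_one'⟩
  have bij : ∀ s, Function.Bijective (fun p : Cylinder => ((p.1, g s p.1 p.2) : Cylinder)) := by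
    refine fun s => ⟨?_, ?_⟩
    · rintro ⟨z, t⟩ ⟨z', t'⟩ e
      obtain ⟨h, e⟩ := Prod.mk.inj e
      obtain rfl : z = z' := h
      exact Prod.ext rfl ((gm s z).injective e)
    · rintro ⟨z, t⟩
      obtain ⟨t', rfl⟩ := gs s z t
      exact ⟨(z, t'), rfl⟩
  have cont : Continuous fun q : unitInterval × Cylinder =>
      ((q.2.1, g q.1 q.2.1 q.2.2) : Cylinder) :=
    (continuous_fst.comp continuous_snd).prodMk gc
  refine ⟨fun s p => (p.1, g s p.1 p.2), cont, fun s => ?_, ?_, ?_, ?_, ?_, ?_⟩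
  -- The cylinder is compact and Hausdorff, so the inverse is continuous for free.
  · rw [isHomeomorph_iff_continuous_bijective]
    exact ⟨cont.comp (continuous_const.prodMk continuous_id), bij s⟩
  · funext p
    refine Prod.ext rfl (Subtype.ext ?_)
    simp [g]
  · rw [image_eq_iff (bij 1)]
    rintro ⟨z, t⟩
    have : g 1 z t = f z t := by ext; simp [g]
    simp [this, h]
  · simp [g0]
  · simp [g1]
  · simp

/-- The piecewise linear homeomorphism of the unit interval with slopes `5`, `1` and `1 / 5` which
shifts `[1/8, 3/8]` to `[5/8, 7/8]`. -/
def shift (t : ℝ) : ℝ := min (5 * t) (min (t + 1 / 2) (4 / 5 + t / 5))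

lemma continuous_shift : Continuous shift := by unfold shift; fun_prop

lemma strictMono_shift : StrictMono shift := fun a b h =>
  min_lt_min (by linarith) (min_lt_min (by linarith) (by linarith))

lemma shift_zero : shift 0 = 0 := by norm_num [shift]

lemma shift_one : shift 1 = 1 := by norm_num [shift]

/-- A saddle in the lower half of a stack has a moving parameter only for `t` in `[1/8, 3/8]`, one
in the upper half only in `[5/8, 7/8]`. There `shift` is the translation by `1/2`; before and after,
both sides have the same constant value, so the other two slopes of `shift` do not matter. -/
lemma saddleLevel_shift (t : ℝ) : saddleLevel (2 * shift t - 1) = saddleLevel (2 * t) := by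
  rcases le_total t (1 / 8) with h | h
  · have : shift t ≤ 5 * t := min_le_left _ _
    rw [saddleLevel_of_le (by linarith), saddleLevel_of_le (by linarith)]
  rcases le_total t (3 / 8) with h' | h'
  · have : shift t = t + 1 / 2 := by
      rw [shift, min_eq_right, min_eq_left]
      · linarith
      · exact min_le_of_left_le (by linarith)
    rw [this]; congr 1; ring
  · have : 7 / 8 ≤ shift t := le_min (by linarith) (le_min (by linarith) (by linarith))
    rw [saddleLevel_of_ge (by linarith), saddleLevel_of_ge (by linarith)]

/-! ### Saddles at different crossings commute -/

namespace OrientedTangleDiagram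

variable (T : OrientedTangleDiagram)

/-- Urysohn's lemma, applied to the closed unit disk of the chart and the complement of a larger
open disk. Charts of different crossings are disjoint, so `ρ` vanishes on the charts of all the
other crossings. -/
lemma exists_cutoff (j : Fin T.n) : ∃ ρ : Disk → ℝ, Continuous ρ ∧ (∀ p, ρ p ∈ Icc (0 : ℝ) 1) ∧
    (∀ z, ‖z‖ ≤ 1 → ρ (T.chart j z) = 1) ∧ ∀ p ∉ range (T.chart j), ρ p = 0 := by
  have hχ := T.isOpenEmbedding_chart j
  -- The radius `2` is arbitrary: any radius above `1` leaves room for the transition.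
  have hd : Disjoint ((T.chart j '' Metric.ball 0 2)ᶜ) (T.chart j '' Metric.closedBall 0 1) :=
    disjoint_compl_left_iff_subset.2
      (image_mono (Metric.closedBall_subset_ball (by norm_num)))
  obtain ⟨ρ, h0, h1, h⟩ := exists_continuous_zero_one_of_isClosed
    (hχ.isOpenMap _ Metric.isOpen_ball).isClosed_compl
    ((isCompact_closedBall 0 1).image hχ.continuous).isClosed hd
  refine ⟨ρ, ρ.continuous, h, fun z hz => h1 ⟨z, by simpa using hz, rfl⟩, fun p hp => h0 ?_⟩
  rintro ⟨z, -, rfl⟩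
  exact hp ⟨z, rfl⟩

/-- The subset of the cylinder swept out by a family of resolutions. -/
def movie (F : ℝ → Fin T.n → ℝ) : Set Cylinder := {p | p.1 ∈ T.resolve (F p.2)}

/-- The factor `bump` vanishes outside the open unit disk, so the parameter of a crossing has no
influence on the resolution there. In a movie this makes the surface vertical outside the small
disks. -/
lemma mem_resolve_congr {f g : Fin T.n → ℝ} {p : Disk}
    (h : ∀ k z, ‖z‖ < 1 → p = T.chart k z → f k = g k) : p ∈ T.resolve f ↔ p ∈ T.resolve g := by
  rcases T.mem_outside_or p with hp | ⟨k, z, rfl⟩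
  · rw [T.mem_resolve_of_notMem _ hp, T.mem_resolve_of_notMem _ hp]
  · rw [chart_mem_resolve, chart_mem_resolve]
    rcases lt_or_ge ‖z‖ 1 with hz | hz
    · rw [h k z hz rfl]
    · rw [bump_of_one_le hz, mul_zero, mul_zero]

/-- Delaying a saddle at one crossing does not change the isotopy class of a movie. -/
lemma isotopic_movie {F F' : ℝ → Fin T.n → ℝ} (j : Fin T.n)
    (hF : ∀ t, F t j = saddleLevel (2 * t)) (hF' : ∀ t, F' t j = saddleLevel (2 * t - 1))
    (hne : ∀ t, ∀ k ≠ j, F t k = F' t k) : Isotopic (T.movie F) (T.movie F') := by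
  obtain ⟨ρ, ρc, ρI, ρ1, ρ0⟩ := T.exists_cutoff j
  have shift_mem : ∀ t : unitInterval, shift t ∈ Icc (0 : ℝ) 1 := fun t =>
    ⟨shift_zero ▸ strictMono_shift.monotone t.2.1, shift_one ▸ strictMono_shift.monotone t.2.2⟩
  -- The amount of shifting is governed by the cutoff: `shift` over the small disk of the `j`-th
  -- crossing, the identity off its chart.
  let f : Disk → unitInterval → unitInterval := fun p t =>
    ⟨(1 - ρ p) * t + ρ p * shift t,
      convex_Icc (0 : ℝ) 1 t.2 (shift_mem t) (sub_nonneg.2 (ρI p).2) (ρI p).1 (by ring)⟩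
  have coe_f : ∀ p t, (f p t : ℝ) = (1 - ρ p) * t + ρ p * shift t := fun _ _ => rfl
  refine Isotopic.of_fibrewise_reparam f ?_ ?_ ?_ ?_ ?_
  · have := continuous_shift
    apply Continuous.subtype_mk
    fun_prop
  · intro p a b hab
    have h1 : (a : ℝ) < b := hab
    have h2 := strictMono_shift h1
    change (1 - ρ p) * a + ρ p * shift a < (1 - ρ p) * b + ρ p * shift b
    rcases eq_or_lt_of_le (ρI p).1 with h | h
    · rw [← h]; linarith
    · have := mul_lt_mul_of_pos_left h2 h
      have := mul_le_mul_of_nonneg_left h1.le (sub_nonneg.2 (ρI p).2)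
      linarith
  · intro p; ext; simp [coe_f, shift_zero]
  · intro p; ext; simp [coe_f, shift_one]
  · intro p t
    -- Only points of the open small disks need to be compared, and there the cutoff is `1` or `0`.
    -- The region with intermediate values of `ρ` lies outside all of them.
    refine T.mem_resolve_congr fun k z hz e => ?_
    subst e
    by_cases hk : k = j
    · subst hk
      have : (f (T.chart k z) t : ℝ) = shift t := by rw [coe_f, ρ1 z hz.le]; ring
      rw [hF', hF, this, saddleLevel_shift]
    · have : (f (T.chart k z) t : ℝ) = t := by
        rw [coe_f, ρ0 _ (Set.disjoint_left.1 (T.disjoint_chart hk) ⟨z, rfl⟩)]; ring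
      rw [this, hne _ k hk]

/-- The parameters of a stack of two saddles: first at the `j`-th and then at the `k`-th
crossing. -/
def saddleFamily₂ (w : Fin T.n → Bool) (j k : Fin T.n) (t : ℝ) (l : Fin T.n) : ℝ :=
  if l = j then saddleLevel (2 * t) else if l = k then saddleLevel (2 * t - 1) else level (w l)

lemma saddle_comp_saddle {w w' w'' : Fin T.n → Bool} {j k : Fin T.n} (h : IsArrow j w w')
    (h' : IsArrow k w' w'') :
    ((T.saddle h).comp (T.saddle h')).carrier = T.movie (T.saddleFamily₂ w j k) := by
  have hjk : k ≠ j := by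
    rintro rfl
    simpa [h.2] using h'.1
  -- The second arrow starts at `w'`, which agrees with `w` away from `j`.
  have hwk : w k = false := by simpa [h.2, hjk] using h'.1
  ext ⟨p, t⟩
  have hm := (T.saddle h).fits (T.saddle h')
  rcases le_total (t : ℝ) (1 / 2) with ht | ht
  · refine (mem_stack_lower hm ht).trans (T.mem_resolve_congr fun l _ _ _ => ?_)
    by_cases hl : l = j
    · simp [saddleFamily, saddleFamily₂, hl, coe_lower ht]
    by_cases hl' : l = k
    · subst hl'
      -- In the lower half `2 * t - 1 ≤ 0`, so the second saddle has not begun and its parameter is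
      -- still that of the letter `0`.
      simp [saddleFamily, saddleFamily₂, hl, hwk, saddleLevel_of_le (t := 2 * (t : ℝ) - 1)
        (by linarith)]
    · simp [saddleFamily, saddleFamily₂, hl, hl']
  · refine (mem_stack_upper hm ht).trans (T.mem_resolve_congr fun l _ _ _ => ?_)
    by_cases hl : l = j
    · subst hl
      -- In the upper half `1 ≤ 2 * t`, so the first saddle is finished and its parameter is that of
      -- the letter `1`.
      simp [saddleFamily, saddleFamily₂, hjk.symm, h.2, saddleLevel_of_ge (t := 2 * (t : ℝ))
        (by linarith)]
    by_cases hl' : l = k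
    · simp [saddleFamily, saddleFamily₂, hl', hjk, coe_upper ht]
    · simp [saddleFamily, saddleFamily₂, hl, hl', h.2]

/-- Saddles at different crossings commute up to isotopy. -/
lemma saddle_comm {w u v x : Fin T.n → Bool} {j k : Fin T.n} (hj : IsArrow j w u)
    (hk : IsArrow k u x) (hk' : IsArrow k w v) (hj' : IsArrow j v x) :
    (T.saddle hj).comp (T.saddle hk) ≈ (T.saddle hk').comp (T.saddle hj') := by
  have hjk : k ≠ j := by
    rintro rfl
    simpa [hj.2] using hk.1
  change Isotopic _ _
  rw [saddle_comp_saddle, saddle_comp_saddle]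
  -- The common intermediate movie: both saddles occur simultaneously, in the upper half. It is
  -- symmetric in `j` and `k`, and each stack reaches it by delaying its lower saddle.
  let F : ℝ → Fin T.n → ℝ := fun t l =>
    if l = j ∨ l = k then saddleLevel (2 * t - 1) else level (w l)
  refine Isotopic.trans (S' := T.movie F) (T.isotopic_movie j ?_ ?_ ?_)
    (Isotopic.symm (T.isotopic_movie k ?_ ?_ ?_))
  · simp [saddleFamily₂]
  · simp [F]
  · intro t l hl
    simp [F, saddleFamily₂, hl]
  · simp [saddleFamily₂]
  · simp [F]
  · intro t l hl
    simp [F, saddleFamily₂, hl]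

/-! ### Signs of the arrows of the cube -/

/-- Raising an earlier letter changes the sign of an arrow. -/
lemma arrowSign_update {n : ℕ} {w : Fin n → Bool} {j : Fin n} (hw : w j = false) (k : Fin n) :
    arrowSign k (Function.update w j true) = if j < k then -arrowSign k w else arrowSign k w := by
  unfold arrowSign
  split_ifs with h
  · have : (Finset.univ.filter fun i => i < k ∧ Function.update w j true i = true) =
        insert j (Finset.univ.filter fun i => i < k ∧ w i = true) := by
      ext i
      by_cases hi : i = j
      · subst hi; simp [h]
      · simp [hi]
    rw [this, Finset.card_insert_of_notMem (by simp [hw]), pow_succ, mul_neg_one]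
  · congr 2
    ext i
    by_cases hi : i = j
    · subst hi; simp [h]
    · simp [hi]

/-- Raising a letter flips the sign of the arrow at the other letter only if the raised one comes
earlier. Of two distinct letters exactly one is earlier, so exactly one of the two products picks up
a minus sign. -/
lemma arrowSign_comm {n : ℕ} {w : Fin n → Bool} {j k : Fin n} (hjk : j ≠ k)
    (hj : w j = false) (hk : w k = false) :
    arrowSign j w * arrowSign k (Function.update w j true) =
      -(arrowSign k w * arrowSign j (Function.update w k true)) := by
  rw [arrowSign_update hj, arrowSign_update hk]
  rcases hjk.lt_or_gt with h | h
  · rw [if_pos h, if_neg h.le.not_gt]; ring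
  · rw [if_neg h.le.not_gt, if_pos h]; ring

/-! ### Faces of the cube and the square of the differential -/

/-- The class of the saddle cobordism of an arrow of the cube, as a morphism of `AddCob`. -/
def saddleHom {w w' : Fin T.n → Bool} {j : Fin T.n} (h : IsArrow j w w') :
    Free.of ℤ (T.smoothing w) ⟶ Free.of ℤ (T.smoothing w') :=
  (Free.embedding ℤ (Cob T.boundary)).map (Quotient.mk _ (T.saddle h))

lemma saddleHom_comm {w u v x : Fin T.n → Bool} {j k : Fin T.n} (hj : IsArrow j w u)
    (hk : IsArrow k u x) (hk' : IsArrow k w v) (hj' : IsArrow j v x) :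
    T.saddleHom hj ≫ T.saddleHom hk = T.saddleHom hk' ≫ T.saddleHom hj' := by
  unfold saddleHom
  refine ((Free.embedding ℤ (Cob T.boundary)).map_comp _ _).symm.trans
    (Eq.trans ?_ ((Free.embedding ℤ (Cob T.boundary)).map_comp _ _))
  exact congrArg _ (Quotient.sound (T.saddle_comm hj hk hk' hj'))

open Classical in
/-- The summand of an entry of the differential that belongs to the `j`-th letter. -/
def entry (j : Fin T.n) (w w' : Fin T.n → Bool) :
    Free.of ℤ (T.smoothing w) ⟶ Free.of ℤ (T.smoothing w') :=
  if h : IsArrow j w w' then arrowSign j w • T.saddleHom h else 0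

lemma entry_of_isArrow {j : Fin T.n} {w w' : Fin T.n → Bool} (h : IsArrow j w w') :
    T.entry j w w' = arrowSign j w • T.saddleHom h := dif_pos h

lemma entry_of_not_isArrow {j : Fin T.n} {w w' : Fin T.n → Bool} (h : ¬IsArrow j w w') :
    T.entry j w w' = 0 := dif_neg h

lemma card_update {n : ℕ} {w : Fin n → Bool} {j : Fin n} (hw : w j = false) :
    (Finset.univ.filter fun k => Function.update w j true k = true).card =
      (Finset.univ.filter fun k => w k = true).card + 1 := by
  rw [← Finset.card_insert_of_notMem (a := j) (by simp [hw])]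
  congr 1
  ext i
  by_cases hi : i = j
  · subst hi; simp
  · simp [hi]

/-- This places the target of an arrow among the indices of the direct sum in the next degree, so
that it occurs as an intermediate state in the matrix product. -/
lemma IsArrow.mem_state {i : ℤ} (w : T.State i) {w' : Fin T.n → Bool} {j : Fin T.n}
    (h : IsArrow j w.1 w') :
    ((Finset.univ.filter fun k => w' k = true).card : ℤ) = i + 1 + T.nNeg := by
  rw [h.2, card_update h.1]
  push_cast
  rw [w.2]; ring

/-- The paths of length two in the cube that change the `j`-th and then the `k`-th letter. -/
lemma sum_entry_comp_entry {i : ℤ} (w : T.State i) (x : Fin T.n → Bool) {j k : Fin T.n}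
    (hj : IsArrow j w.1 (Function.update w.1 j true)) :
    ∑ u : T.State (i + 1), T.entry j w.1 u.1 ≫ T.entry k u.1 x =
      T.entry j w.1 (Function.update w.1 j true) ≫ T.entry k (Function.update w.1 j true) x := by
  -- The source and the letter of an arrow determine its target, so a single intermediate state
  -- contributes.
  refine Finset.sum_eq_single (⟨Function.update w.1 j true, IsArrow.mem_state T w hj⟩ :
    T.State (i + 1)) (fun u _ hu => ?_) (fun h => absurd (Finset.mem_univ _) h)
  rw [T.entry_of_not_isArrow fun h => hu (Subtype.ext h.2), Limits.zero_comp]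

lemma sum_entry_comp_entry_eq_zero {i : ℤ} (w : T.State i) (x : Fin T.n → Bool) {j k : Fin T.n}
    (h : ∀ u, IsArrow j w.1 u → ¬IsArrow k u x) :
    ∑ u : T.State (i + 1), T.entry j w.1 u.1 ≫ T.entry k u.1 x = 0 := by
  refine Finset.sum_eq_zero fun u _ => ?_
  by_cases hj : IsArrow j w.1 u.1
  · rw [T.entry_of_not_isArrow (h _ hj), Limits.comp_zero]
  · rw [T.entry_of_not_isArrow hj, Limits.zero_comp]

/-- The faces of the cube anticommute. -/
lemma sum_entry_anticomm {i : ℤ} (w : T.State i) (x : Fin T.n → Bool) (j k : Fin T.n) :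
    ∑ u : T.State (i + 1), T.entry j w.1 u.1 ≫ T.entry k u.1 x +
      ∑ u : T.State (i + 1), T.entry k w.1 u.1 ≫ T.entry j u.1 x = 0 := by
  -- The condition says that `w` and `x` are opposite corners of a face in the directions `j` and
  -- `k`. It is symmetric in the two letters, so when it fails neither path exists and both sums
  -- vanish; this includes `j = k`.
  by_cases h : j ≠ k ∧ w.1 j = false ∧ w.1 k = false ∧
    x = Function.update (Function.update w.1 j true) k true
  · obtain ⟨hjk, hj, hk, rfl⟩ := h
    have aj : IsArrow j w.1 (Function.update w.1 j true) := ⟨hj, rfl⟩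
    have ak : IsArrow k w.1 (Function.update w.1 k true) := ⟨hk, rfl⟩
    have ajk : IsArrow k (Function.update w.1 j true)
        (Function.update (Function.update w.1 j true) k true) := ⟨by simp [hjk.symm, hk], rfl⟩
    have akj : IsArrow j (Function.update w.1 k true)
        (Function.update (Function.update w.1 j true) k true) :=
      ⟨by simp [hjk, hj], Function.update_comm hjk _ _ _⟩
    -- Each sum reduces to one path; both paths carry the same composite of saddles, with opposite
    -- integer coefficients.
    rw [T.sum_entry_comp_entry w _ aj, T.sum_entry_comp_entry w _ ak, T.entry_of_isArrow aj,
      T.entry_of_isArrow ak, T.entry_of_isArrow ajk, T.entry_of_isArrow akj,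
      Preadditive.zsmul_comp, Preadditive.comp_zsmul, Preadditive.zsmul_comp,
      Preadditive.comp_zsmul, smul_smul, smul_smul, T.saddleHom_comm aj ajk ak akj, ← add_smul,
      arrowSign_comm hjk hj hk, neg_add_cancel, zero_smul]
  · rw [T.sum_entry_comp_entry_eq_zero w x, T.sum_entry_comp_entry_eq_zero w x, add_zero]
    · rintro u ⟨hk, rfl⟩ ⟨hj, rfl⟩
      have hjk : j ≠ k := by rintro rfl; simp at hj
      exact h ⟨hjk, by simpa [hjk] using hj, hk, (Function.update_comm hjk _ _ _).symm⟩
    · rintro u ⟨hj, rfl⟩ ⟨hk, rfl⟩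
      have hjk : j ≠ k := by rintro rfl; simp at hk
      exact h ⟨hjk, hj, by simpa [hjk.symm] using hk, rfl⟩

lemma sum_entry_comp_sum_entry (w u x : Fin T.n → Bool) :
    (∑ j, T.entry j w u) ≫ (∑ k, T.entry k u x) =
      ∑ p : Fin T.n × Fin T.n, T.entry p.1 w u ≫ T.entry p.2 u x := by
  rw [Fintype.sum_prod_type, Preadditive.sum_comp]
  exact Finset.sum_congr rfl fun j _ => Preadditive.comp_sum _ _ _

/-- After interchanging the sums, an entry is a sum over pairs of letters `(j, k)`, and exchanging
the two letters is an involution under which the terms cancel. -/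
lemma bracketD_comp_bracketD (i : ℤ) : T.bracketD i ≫ T.bracketD (i + 1) = 0 := by
  refine Mat_.hom_ext _ _ fun w x => ?_
  have swap : (T.bracketD i ≫ T.bracketD (i + 1)) w x =
      ∑ p : Fin T.n × Fin T.n,
        ∑ u : T.State (i + 1), T.entry p.1 w.1 u.1 ≫ T.entry p.2 u.1 x.1 := by
    rw [Finset.sum_comm]
    -- By definition the entries of `bracketD` are the sums of `entry` over all letters, and the
    -- composite is the matrix product.
    exact Finset.sum_congr rfl fun u _ => T.sum_entry_comp_sum_entry w.1 u.1 x.1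
  rw [swap]
  refine Finset.sum_involution (fun p _ => p.swap) (fun p _ => T.sum_entry_anticomm w x.1 p.1 p.2)
    (fun p _ hp e => hp ?_) (fun _ _ => Finset.mem_univ _) (fun p _ => p.swap_swap)
  obtain ⟨j, k⟩ := p
  obtain rfl : k = j := congrArg Prod.fst e
  -- The involution fixes the diagonal pairs, whose terms must vanish on their own: a letter already
  -- raised to `1` cannot be raised again.
  refine T.sum_entry_comp_entry_eq_zero w x.1 ?_
  rintro u ⟨-, rfl⟩ ⟨hj, -⟩
  simp at hj

/-! ### Finite length -/

lemma isZero_bracketX {i : ℤ} (h : IsEmpty (T.State i)) : Limits.IsZero (T.bracketX i) := by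
  rw [Limits.IsZero.iff_id_eq_zero]
  exact Mat_.hom_ext _ _ fun w => h.elim w

/-- A state in degree `i` has `i + n₋` letters `1`, a number between `0` and `n`. Outside `[-n₋, n -
n₋]` the direct sum is therefore empty. -/
lemma finite_bracketX : {i : ℤ | ¬ Limits.IsZero (T.bracketX i)}.Finite := by
  refine (Set.finite_Icc (-(T.nNeg : ℤ)) (T.n - T.nNeg)).subset fun i hi => ?_
  by_contra hi'
  refine hi (T.isZero_bracketX ⟨fun w => hi' ?_⟩)
  have h1 := w.2
  have h2 := Finset.card_filter_le Finset.univ fun k => w.1 k = true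
  rw [Finset.card_univ, Fintype.card_fin] at h2
  constructor <;> omega

end OrientedTangleDiagram

end Khovanov

end

theorem mainTheorem1 (T : Khovanov.OrientedTangleDiagram) :
    ∃ (hd : ∀ i : ℤ, T.bracketD i ≫ T.bracketD (i + 1) = 0)
      (K : Khovanov.Kom (CategoryTheory.Mat_ (Khovanov.AddCob T.boundary))),
      K.obj = CochainComplex.of T.bracketX T.bracketD hd :=
  -- The terms of `CochainComplex.of` are those of `bracketX` by definition, so `finite_bracketX` is
  -- literally the finite length property.
  ⟨T.bracketD_comp_bracketD, ⟨CochainComplex.of T.bracketX T.bracketD T.bracketD_comp_bracketD,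
    T.finite_bracketX⟩, rfl⟩
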